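/- Let $d\ge 0$, $T>0$, $N\ge 1$, $K\ge 0$. Let $\mathcal H:[0,T]\times\mathbb R^d\times\mathbb R^d\to\mathbb R$ be convex in $p$ with $|\mathcal H_p|\le 2N$, $|\mathcal H_t|,|\mathcal H_x|\le K(1+|p|)$ and $|\mathcal H(t,x,0)|\le K$ (the derivative bounds being understood as Lipschitz bounds, so $\mathcal H$ need not be differentiable). Let $\mathcal L(t,x,\mu)=\sup_{p}[p\cdot\mu-\mathcal H(t,x,p)]$ be its Legendre transform and let $\alpha(t,x,p)=\nabla_p\mathcal H(t,x,p)$ (any element of the subdifferential of $\mathcal H(t,x,\cdot)$ at $p$ where $\mathcal H(t,x,\cdot)$ is not differentiable), which maximizes $\mu\mapsto p\cdot\mu-\mathcal L(t,x,\mu)$. Let $q:\mathbb R^d\to\mathbb R$ be bounded by $K$ and Lipschitz with constant $K$. For $h>0$ put $$\nabla^h\varphi(x)=\Big(\tfrac{\varphi(x+he_i)-\varphi(x-he_i)}{2h}\Big)_{i=1}^d,\qquad \Delta^h\varphi(x)=\sum_{i=1}^d\frac{\varphi(x+he_i)-2\varphi(x)+\varphi(x-he_i)}{h^2}.$$ Let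 $v^h$ be a Lipschitz continuous solution of $$\partial_t v^h+\mathcal H(t,x,\nabla^h v^h)=Nh\Delta^h v^h\ \text{ in }(0,T)\times\mathbb R^d,\qquad v^h(0,\cdot)=q .$$ Let $v_0^h:[0,T]\times\mathbb R^d\to\mathbb R$ be bounded by $K$ and Lipschitz with constant $K$, and for $n\ge1$ let $v_n^h$ be a Lipschitz continuous solution of $$\partial_t v_n^h+\mu_{n-1}^h\cdot\nabla^h v_n^h-\mathcal L(t,x,\mu_{n-1}^h)=Nh\Delta^h v_n^h\ \text{ in }(0,T)\times\mathbb R^d,\qquad v_n^h(0,\cdot)=q,$$ where $\mu_{n}^h(t,x)=\alpha(t,x,\nabla^h v_{n}^h(t,x))$. Then there is a constant $C>0$ depending only on $d,T,N,K$ such that for all $h>0$: 1. for all $n\ge1$, $R\ge1$ and $t\in[0,T]$, $$\int_{B_R}|v_n^h(t,x)-v^h(t,x)|^2\,dx\le C\,2^{-n}\,h\,e^{Ct/h}R^d;$$ 2. if moreover $\alpha(t,x,\cdot)$ is Lipschitz with constant $\Lambda$ for all $(t,x)\in[0,T]\times\mathbb R^d$, then, with a constant $C'$ depending only on $d,T,N,K,\Lambda$,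 for all $n\ge0$, $R\ge1$ and $t\in[0,T]$, $$\int_{B_R}\big|\alpha(t,x,\nabla^h v_n^h(t,x))-\alpha(t,x,\nabla^h v^h(t,x))\big|^2\,dx\le C'\,2^{-n}e^{C't/h}R^d/h;$$ 3. if $v$ is a Lipschitz continuous viscosity solution of $\partial_t v+\mathcal H(t,x,\nabla v)=0$ in $(0,T)\times\mathbb R^d$, $v(0,\cdot)=q$, then $$\sup_{(t,x)\in[0,T]\times\mathbb R^d}|v^h(t,x)-v(t,x)|\le C\sqrt h .$$ -/

import Mathlib

open Set Filter Topology MeasureTheory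
open scoped NNReal

/-- Euclidean space of dimension `d`. -/
abbrev Sp (d : ℕ) : Type := EuclideanSpace ℝ (Fin d)

noncomputable section

/-- Central difference gradient: the `i`-th entry is `(φ(x + h eᵢ) - φ(x - h eᵢ)) / (2h)`. -/
def gradH {d : ℕ} (h : ℝ) (φ : Sp d → ℝ) (x : Sp d) : Sp d :=
  WithLp.toLp 2 fun i =>
    (φ (x + h • EuclideanSpace.single i (1 : ℝ)) - φ (x - h • EuclideanSpace.single i (1 : ℝ)))
      / (2 * h)

/-- Discrete Laplacian `∑ᵢ (φ(x + h eᵢ) - 2 φ(x) + φ(x - h eᵢ)) / h²`. -/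
def lapH {d : ℕ} (h : ℝ) (φ : Sp d → ℝ) (x : Sp d) : ℝ :=
  ∑ i : Fin d,
    (φ (x + h • EuclideanSpace.single i (1 : ℝ)) - 2 * φ x
      + φ (x - h • EuclideanSpace.single i (1 : ℝ))) / h ^ 2

/-- Legendre transform `μ ↦ sup_p [p · μ - F p]` of a function on `ℝᵈ`. It is used below only at
subgradients `μ` of `F`, where the supremum is attained (`legendre_eq_of_isSubgradient`). -/
def legendre {d : ℕ} (F : Sp d → ℝ) (μ : Sp d) : ℝ :=
  ⨆ p : Sp d, (inner ℝ p μ - F p)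

/-- `μ` belongs to the subdifferential of `F` at `p`. Where `F` is differentiable this says
`μ = ∇F(p)` (`IsSubgradient.eq_gradient`). -/
def IsSubgradient {d : ℕ} (F : Sp d → ℝ) (p μ : Sp d) : Prop :=
  ∀ p' : Sp d, F p + inner ℝ μ (p' - p) ≤ F p'

theorem legendre_eq_of_isSubgradient {d : ℕ} {F : Sp d → ℝ} {p μ : Sp d}
    (hμ : IsSubgradient F p μ) : legendre F μ = inner ℝ p μ - F p := by
  have key : ∀ p' : Sp d, inner ℝ p' μ - F p' ≤ inner ℝ p μ - F p := by
    intro p'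
    have h1 := hμ p'
    rw [inner_sub_right, real_inner_comm p' μ, real_inner_comm p μ] at h1
    linarith
  refine le_antisymm (ciSup_le key) (le_ciSup (f := fun p' : Sp d => inner ℝ p' μ - F p') ?_ p)
  exact ⟨_, by rintro _ ⟨p', rfl⟩; exact key p'⟩

theorem IsSubgradient.eq_gradient {d : ℕ} {F : Sp d → ℝ} {p μ : Sp d}
    (hμ : IsSubgradient F p μ) (hF : DifferentiableAt ℝ F p) : μ = gradient F p := by
  have h1 : HasFDerivAt F (innerSL ℝ (gradient F p)) p := hF.hasGradientAt.hasFDerivAt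
  have h2 : HasFDerivAt (fun p' : Sp d => F p' - inner ℝ μ p')
      (innerSL ℝ (gradient F p) - innerSL ℝ μ) p := h1.sub (innerSL ℝ μ).hasFDerivAt
  have h3 : IsLocalMin (fun p' : Sp d => F p' - inner ℝ μ p') p := by
    refine Filter.Eventually.of_forall fun p' => ?_
    have h := hμ p'
    rw [inner_sub_right] at h
    show F p - inner ℝ μ p ≤ F p' - inner ℝ μ p'
    linarith
  have h4 := h3.hasFDerivAt_eq_zero h2
  have h5 : innerSL ℝ (gradient F p) = innerSL ℝ μ := sub_eq_zero.mp h4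
  exact (ext_inner_right ℝ fun y => by simpa using congrArg (fun g => g y) h5).symm

/-- The standing assumptions on the (truncated) Hamiltonian `H(t,x,p)` on `[0,T] × ℝᵈ × ℝᵈ`:
convexity in `p`; `|H_p| ≤ 2N`; `|H_t|, |H_x| ≤ K (1 + |p|)`; `|H(t,x,0)| ≤ K`. The derivative
bounds are expressed by difference quotients, since a truncated Hamiltonian is in general only
Lipschitz continuous. -/
structure IsAdmissibleHamiltonian {d : ℕ} (T N K : ℝ) (H : ℝ → Sp d → Sp d → ℝ) : Prop where
  convex : ∀ t ∈ Icc 0 T, ∀ x, ConvexOn ℝ univ (H t x)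
  bound_p : ∀ t ∈ Icc 0 T, ∀ x p p', |H t x p - H t x p'| ≤ 2 * N * ‖p - p'‖
  bound_t : ∀ s ∈ Icc 0 T, ∀ t ∈ Icc 0 T, ∀ x p, |H t x p - H s x p| ≤ K * (1 + ‖p‖) * |t - s|
  bound_x : ∀ t ∈ Icc 0 T, ∀ x y p, |H t x p - H t y p| ≤ K * (1 + ‖p‖) * ‖x - y‖
  bound_zero : ∀ t ∈ Icc 0 T, ∀ x, |H t x 0| ≤ K

/-- `α` is the policy map attached to `H`: `α(t,x,p) = ∇_p H(t,x,p)`, that is, the maximizer of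
`μ ↦ p · μ - L(t,x,μ)` with `L` the Legendre transform of `H`. At points where `H(t,x,·)` is not
differentiable, any element of the subdifferential is allowed. -/
def IsPolicyMap {d : ℕ} (T : ℝ) (H : ℝ → Sp d → Sp d → ℝ) (α : ℝ → Sp d → Sp d → Sp d) : Prop :=
  ∀ t ∈ Icc 0 T, ∀ x p, IsSubgradient (H t x) p (α t x p)

/-- `u` is Lipschitz continuous on `[0,T] × ℝᵈ` with constant `L`. -/
def LipOn {d : ℕ} (T : ℝ) (L : ℝ≥0) (u : ℝ → Sp d → ℝ) : Prop :=
  LipschitzOnWith L (fun z : ℝ × Sp d => u z.1 z.2) (Icc 0 T ×ˢ univ)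

/-- `u` is a Lipschitz continuous solution of the semi-discrete scheme
`∂ₜu + H(t,x,∇ʰu) = N h Δʰu` in `(0,T) × ℝᵈ`, `u(0,·) = q`. -/
structure IsSchemeSolution {d : ℕ} (T N h : ℝ) (H : ℝ → Sp d → Sp d → ℝ) (q : Sp d → ℝ)
    (u : ℝ → Sp d → ℝ) : Prop where
  lipschitz : ∃ L : ℝ≥0, LipOn T L u
  initial : ∀ x, u 0 x = q x
  differentiable : ∀ t ∈ Ioo 0 T, ∀ x, DifferentiableAt ℝ (fun s => u s x) t
  equation : ∀ t ∈ Ioo 0 T, ∀ x,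
    deriv (fun s => u s x) t + H t x (gradH h (u t) x) = N * h * lapH h (u t) x

/-- `u` is a Lipschitz continuous solution of the linear equation
`∂ₜu + μ(t,x) · ∇ʰu - L(t,x,μ(t,x)) = N h Δʰu` in `(0,T) × ℝᵈ`, `u(0,·) = q`, where
`L(t,x,·)` is the Legendre transform of `H(t,x,·)`. -/
structure IsLinearizedSolution {d : ℕ} (T N h : ℝ) (H : ℝ → Sp d → Sp d → ℝ) (q : Sp d → ℝ)
    (μ : ℝ → Sp d → Sp d) (u : ℝ → Sp d → ℝ) : Prop where
  lipschitz : ∃ L : ℝ≥0, LipOn T L u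
  initial : ∀ x, u 0 x = q x
  differentiable : ∀ t ∈ Ioo 0 T, ∀ x, DifferentiableAt ℝ (fun s => u s x) t
  equation : ∀ t ∈ Ioo 0 T, ∀ x,
    deriv (fun s => u s x) t + inner ℝ (μ t x) (gradH h (u t) x) - legendre (H t x) (μ t x)
      = N * h * lapH h (u t) x

/-- `v : ℕ → ℝ → ℝᵈ → ℝ` is a sequence of policy iterates: `v 0` is bounded by `K` and Lipschitz
continuous with constant `K`, and `v (n+1)` solves the linear equation with coefficient
`μ(t,x) = α(t,x,∇ʰ(v n)(t,x))`. -/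
structure IsPolicyIteration {d : ℕ} (T N : ℝ) (K : ℝ≥0) (h : ℝ) (H : ℝ → Sp d → Sp d → ℝ)
    (α : ℝ → Sp d → Sp d → Sp d) (q : Sp d → ℝ) (v : ℕ → ℝ → Sp d → ℝ) : Prop where
  start_bounded : ∀ t ∈ Icc 0 T, ∀ x, |v 0 t x| ≤ K
  start_lipschitz : LipOn T K (v 0)
  step : ∀ n, IsLinearizedSolution T N h H q (fun t x => α t x (gradH h (v n t) x)) (v (n + 1))

/-- `v` is a Lipschitz continuous viscosity solution of
`∂ₜv + H(t,x,∇v) = 0` in `(0,T) × ℝᵈ`, `v(0,·) = q`. -/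
structure IsViscositySolution {d : ℕ} (T : ℝ) (H : ℝ → Sp d → Sp d → ℝ) (q : Sp d → ℝ)
    (v : ℝ → Sp d → ℝ) : Prop where
  lipschitz : ∃ L : ℝ≥0, LipOn T L v
  initial : ∀ x, v 0 x = q x
  subsolution : ∀ φ : ℝ × Sp d → ℝ, ContDiff ℝ 1 φ → ∀ t ∈ Ioo 0 T, ∀ x,
    IsLocalMax (fun z : ℝ × Sp d => v z.1 z.2 - φ z) (t, x) →
      deriv (fun s => φ (s, x)) t + H t x (gradient (fun y => φ (t, y)) x) ≤ 0
  supersolution : ∀ φ : ℝ × Sp d → ℝ, ContDiff ℝ 1 φ → ∀ t ∈ Ioo 0 T, ∀ x,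
    IsLocalMin (fun z : ℝ × Sp d => v z.1 z.2 - φ z) (t, x) →
      0 ≤ deriv (fun s => φ (s, x)) t + H t x (gradient (fun y => φ (t, y)) x)

end

/-! The artificial viscosity `N h Δʰ` exactly balances the bound `2N` on `H_p`: in each direction
`2N|∇ʰw| + N h Δʰw` sees the two neighbouring values only through their maximum, so the scheme is
monotone (`gradH_add_lapH_le`). Hence a comparison principle with source terms
(`le_of_deriv_le_scheme`), which yields a sup bound and a spatial Lipschitz bound for `vʰ` uniform
in `h`.

Policy iteration: Legendre duality at the chosen subgradient shows that the error `vₙ₊₁ - vʰ`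
satisfies the scheme inequality with source `4N|∇ʰ(vₙ - vʰ)|`. In sup norm a central difference
costs at most `d/h`, so comparison gives the Picard bound `A (4Nd/h)ⁿ tⁿ⁺¹/(n+1)!`
(`IsPolicyIteration.abs_sub_le`). Factorial decay is traded for `2⁻ⁿ` at the price of `exp(Ct/h)`.
The integral estimates are these pointwise bounds times the volume of the ball; no energy estimate
is needed.

Rate: variables are doubled in space only, with penalty `|x - y|²/(2√h)`. Central differences are
exact on quadratics, so the only consistency error is `N h Δʰ` of the penalty, equal to `N d √h`;
the Lipschitz bound gives `|x - y| = O(√h)` at the maximum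
(`IsSchemeSolution.sub_supersolution_le`). The opposite inequality follows by reflection `u ↦ -u`.
-/

/-! ### Discrete operators -/

section DiscreteOperators

variable {d : ℕ}

theorem EuclideanSpace.norm_le_sum_abs (p : Sp d) : ‖p‖ ≤ ∑ i, |p i| := by
  rw [EuclideanSpace.norm_eq]
  refine Real.sqrt_le_iff.mpr ⟨Finset.sum_nonneg fun i _ => abs_nonneg _, ?_⟩
  simpa only [Real.norm_eq_abs] using
    Finset.sum_sq_le_sq_sum_of_nonneg (s := Finset.univ) (f := fun i => |p i|)
      fun i _ => abs_nonneg _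

theorem gradH_apply (h : ℝ) (φ : Sp d → ℝ) (x : Sp d) (i : Fin d) :
    gradH h φ x i = (φ (x + h • EuclideanSpace.single i (1 : ℝ))
      - φ (x - h • EuclideanSpace.single i (1 : ℝ))) / (2 * h) := rfl

theorem gradH_sub (h : ℝ) (φ ψ : Sp d → ℝ) (x : Sp d) :
    gradH h (fun y => φ y - ψ y) x = gradH h φ x - gradH h ψ x := by
  ext i
  simp only [gradH_apply, PiLp.sub_apply]
  ring

theorem gradH_neg (h : ℝ) (φ : Sp d → ℝ) (x : Sp d) :
    gradH h (fun y => -φ y) x = -gradH h φ x := by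
  ext i
  simp only [gradH_apply, PiLp.neg_apply]
  ring

theorem gradH_comp_add (h : ℝ) (φ : Sp d → ℝ) (x z : Sp d) :
    gradH h (fun y => φ (y + z)) x = gradH h φ (x + z) := by
  ext i
  simp only [gradH_apply]
  rw [add_right_comm, add_sub_right_comm]

theorem lapH_sub (h : ℝ) (φ ψ : Sp d → ℝ) (x : Sp d) :
    lapH h (fun y => φ y - ψ y) x = lapH h φ x - lapH h ψ x := by
  simp only [lapH, ← Finset.sum_sub_distrib]
  exact Finset.sum_congr rfl fun i _ => by ring

theorem lapH_neg (h : ℝ) (φ : Sp d → ℝ) (x : Sp d) :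
    lapH h (fun y => -φ y) x = -lapH h φ x := by
  simp only [lapH, ← Finset.sum_neg_distrib]
  exact Finset.sum_congr rfl fun i _ => by ring

theorem lapH_comp_add (h : ℝ) (φ : Sp d → ℝ) (x z : Sp d) :
    lapH h (fun y => φ (y + z)) x = lapH h φ (x + z) := by
  simp only [lapH]
  exact Finset.sum_congr rfl fun i _ => by rw [add_right_comm, add_sub_right_comm]

theorem norm_gradH_le_sum {h : ℝ} (hh : 0 < h) (φ : Sp d → ℝ) (x : Sp d) :
    ‖gradH h φ x‖ ≤ ∑ i, |φ (x + h • EuclideanSpace.single i (1 : ℝ))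
      - φ (x - h • EuclideanSpace.single i (1 : ℝ))| / (2 * h) := by
  refine (EuclideanSpace.norm_le_sum_abs _).trans (Finset.sum_le_sum fun i _ => ?_)
  rw [gradH_apply, abs_div, abs_of_pos (by positivity : 0 < 2 * h)]

theorem norm_gradH_le_of_abs_le {h B : ℝ} (hh : 0 < h) {φ : Sp d → ℝ} (hφ : ∀ y, |φ y| ≤ B)
    (x : Sp d) : ‖gradH h φ x‖ ≤ d * B / h := by
  refine (norm_gradH_le_sum hh φ x).trans ?_
  calc _ ≤ ∑ _i : Fin d, B / h := Finset.sum_le_sum fun i _ => by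
        rw [div_le_div_iff₀ (by positivity) hh]
        have := (abs_sub (φ (x + h • EuclideanSpace.single i (1 : ℝ)))
          (φ (x - h • EuclideanSpace.single i (1 : ℝ)))).trans (add_le_add (hφ _) (hφ _))
        nlinarith
    _ = _ := by simp [mul_div_assoc]

theorem norm_gradH_le_of_lipschitz {h L : ℝ} (hh : 0 < h) {φ : Sp d → ℝ}
    (hφ : ∀ y z, |φ y - φ z| ≤ L * ‖y - z‖) (x : Sp d) : ‖gradH h φ x‖ ≤ d * L := by
  refine (norm_gradH_le_sum hh φ x).trans ?_
  calc _ ≤ ∑ _i : Fin d, L := Finset.sum_le_sum fun i _ => by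
        rw [div_le_iff₀ (by positivity)]
        refine (hφ _ _).trans (le_of_eq ?_)
        rw [show x + h • EuclideanSpace.single i (1 : ℝ) - (x - h • EuclideanSpace.single i (1 : ℝ))
          = (2 * h) • EuclideanSpace.single i (1 : ℝ) by rw [two_mul, add_smul]; abel,
          norm_smul, PiLp.norm_single, Real.norm_of_nonneg (by positivity)]
        simp
    _ = _ := by simp

theorem abs_lapH_le_of_abs_le {h B : ℝ} (hh : 0 < h) {φ : Sp d → ℝ} (hφ : ∀ y, |φ y| ≤ B)
    (x : Sp d) : |lapH h φ x| ≤ d * (4 * B / h ^ 2) := by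
  refine (Finset.abs_sum_le_sum_abs _ _).trans ?_
  calc _ ≤ ∑ _i : Fin d, 4 * B / h ^ 2 := Finset.sum_le_sum fun i _ => by
        rw [abs_div, abs_of_pos (by positivity : 0 < h ^ 2)]
        gcongr
        have h1 := abs_le.mp (hφ (x + h • EuclideanSpace.single i (1 : ℝ)))
        have h2 := abs_le.mp (hφ (x - h • EuclideanSpace.single i (1 : ℝ)))
        have h3 := abs_le.mp (hφ x)
        rw [abs_le]
        constructor <;> linarith
    _ = _ := by simp

/-- Monotonicity of the scheme. -/
theorem gradH_add_lapH_le {N h S : ℝ} (hN : 0 ≤ N) (hh : 0 < h) {w : Sp d → ℝ}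
    (hw : ∀ y, w y ≤ S) (x : Sp d) :
    2 * N * ‖gradH h w x‖ + N * h * lapH h w x ≤ 2 * N * d / h * (S - w x) := by
  calc _ ≤ 2 * N * (∑ i, |w (x + h • EuclideanSpace.single i (1 : ℝ))
          - w (x - h • EuclideanSpace.single i (1 : ℝ))| / (2 * h)) + N * h * lapH h w x := by
        gcongr
        exact norm_gradH_le_sum hh w x
    _ ≤ ∑ _i : Fin d, 2 * N / h * (S - w x) := by
        rw [lapH, Finset.mul_sum, Finset.mul_sum, ← Finset.sum_add_distrib]
        refine Finset.sum_le_sum fun i _ => ?_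
        have h1 := hw (x + h • EuclideanSpace.single i (1 : ℝ))
        have h2 := hw (x - h • EuclideanSpace.single i (1 : ℝ))
        generalize w (x + h • EuclideanSpace.single i (1 : ℝ)) = a at *
        generalize w (x - h • EuclideanSpace.single i (1 : ℝ)) = b at *
        -- The left side is `2 max(a, b) - 2 w x`.
        have h3 : |a - b| + (a - 2 * w x + b) ≤ 2 * (S - w x) := by
          rcases abs_cases (a - b) with h | h <;> linarith [h.1]
        have h4 : 2 * N * (|a - b| / (2 * h)) + N * h * ((a - 2 * w x + b) / h ^ 2)
            = N / h * (|a - b| + (a - 2 * w x + b)) := by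
          field_simp
        rw [h4, show 2 * N / h * (S - w x) = N / h * (2 * (S - w x)) by ring]
        exact mul_le_mul_of_nonneg_left h3 (by positivity)
    _ = _ := by simp; ring

theorem norm_add_smul_single_sq (u : Sp d) (c : ℝ) (i : Fin d) :
    ‖u + c • EuclideanSpace.single i (1 : ℝ)‖ ^ 2 = ‖u‖ ^ 2 + 2 * c * u i + c ^ 2 := by
  rw [norm_add_sq_real, inner_smul_right, EuclideanSpace.inner_single_right, norm_smul,
    PiLp.norm_single, norm_one, mul_one, Real.norm_eq_abs, sq_abs, conj_trivial, one_mul]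
  ring

theorem norm_add_smul_single_sub_sq (x y : Sp d) (h : ℝ) (i : Fin d) :
    ‖x + h • EuclideanSpace.single i (1 : ℝ) - y‖ ^ 2
      = ‖x - y‖ ^ 2 + 2 * h * (x - y) i + h ^ 2 := by
  rw [add_sub_right_comm, norm_add_smul_single_sq]

theorem norm_sub_smul_single_sub_sq (x y : Sp d) (h : ℝ) (i : Fin d) :
    ‖x - h • EuclideanSpace.single i (1 : ℝ) - y‖ ^ 2
      = ‖x - y‖ ^ 2 - 2 * h * (x - y) i + h ^ 2 := by
  rw [sub_right_comm, sub_eq_add_neg, ← neg_smul, norm_add_smul_single_sq]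
  ring

/-- Central differences are exact on quadratics. -/
theorem gradH_norm_sub_sq {h : ℝ} (hh : h ≠ 0) (c : ℝ) (x y : Sp d) :
    gradH h (fun z => c * ‖z - y‖ ^ 2) x = (2 * c) • (x - y) := by
  ext i
  rw [gradH_apply, norm_add_smul_single_sub_sq, norm_sub_smul_single_sub_sq, PiLp.smul_apply,
    smul_eq_mul]
  field_simp
  ring

theorem lapH_norm_sub_sq {h : ℝ} (hh : h ≠ 0) (c : ℝ) (x y : Sp d) :
    lapH h (fun z => c * ‖z - y‖ ^ 2) x = 2 * c * d := by
  have key : ∀ i : Fin d, (c * ‖x + h • EuclideanSpace.single i (1 : ℝ) - y‖ ^ 2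
      - 2 * (c * ‖x - y‖ ^ 2) + c * ‖x - h • EuclideanSpace.single i (1 : ℝ) - y‖ ^ 2) / h ^ 2
      = 2 * c := by
    intro i
    rw [norm_add_smul_single_sub_sq, norm_sub_smul_single_sub_sq]
    field_simp
    ring
  simp only [lapH, key]
  simp
  ring

end DiscreteOperators

/-! ### Comparison principle -/

section Comparison

/-- A supremum over `X` need not be attained, so no maximum point is used. Instead a bound `B' ≥ 0`
improves itself: integrating `(exp(lt)(w - B'))' ≤ 0` from `w ≤ 0` at time zero gives `w ≤ B'(1 -
exp(-lT))`, and iteration drives the bound to zero. -/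
theorem nonpos_of_deriv_le_mul_sub {X : Type*} {T l B : ℝ} (hl : 0 ≤ l) {w : ℝ → X → ℝ}
    (hcont : ∀ x, ContinuousOn (fun t => w t x) (Icc 0 T))
    (hdiff : ∀ t ∈ Ioo 0 T, ∀ x, DifferentiableAt ℝ (fun s => w s x) t)
    (hbdd : ∀ t ∈ Icc 0 T, ∀ x, w t x ≤ B) (hinit : ∀ x, w 0 x ≤ 0)
    (hderiv : ∀ t ∈ Ioo 0 T, ∀ x S, (∀ y, w t y ≤ S) →
      deriv (fun s => w s x) t ≤ l * (S - w t x)) :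
    ∀ t ∈ Icc 0 T, ∀ x, w t x ≤ 0 := by
  intro t ht x
  have hT : 0 ≤ T := ht.1.trans ht.2
  have hθ0 : 0 ≤ 1 - Real.exp (-(l * T)) := by
    have : Real.exp (-(l * T)) ≤ 1 := Real.exp_le_one_iff.mpr (by nlinarith)
    linarith
  have hθ1 : 1 - Real.exp (-(l * T)) < 1 := by linarith [Real.exp_pos (-(l * T))]
  have step : ∀ n : ℕ, ∀ t ∈ Icc 0 T, ∀ x, w t x ≤ max B 0 * (1 - Real.exp (-(l * T))) ^ n := by
    intro n
    induction n with
    | zero => intro t ht x; simpa using Or.inl (hbdd t ht x)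
    | succ n ih =>
      intro t ht x
      set B' := max B 0 * (1 - Real.exp (-(l * T))) ^ n
      have hB' : 0 ≤ B' := mul_nonneg (le_max_right _ _) (pow_nonneg hθ0 n)
      have hd : ∀ s ∈ Ioo 0 T, HasDerivAt (fun s => Real.exp (l * s) * (w s x - B'))
          (Real.exp (l * s) * l * (w s x - B') + Real.exp (l * s) * deriv (fun s => w s x) s) s := by
        intro s hs
        have h1 : HasDerivAt (fun s => Real.exp (l * s)) (Real.exp (l * s) * l) s := by
          simpa using ((hasDerivAt_id s).const_mul l).exp
        exact h1.mul ((hdiff s hs x).hasDerivAt.sub_const B')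
      have hanti : AntitoneOn (fun s => Real.exp (l * s) * (w s x - B')) (Icc 0 T) := by
        refine antitoneOn_of_deriv_nonpos (convex_Icc 0 T) ?_ ?_ ?_
        · exact (Continuous.continuousOn (by fun_prop)).mul ((hcont x).sub continuousOn_const)
        · rw [interior_Icc]
          exact fun s hs => (hd s hs).differentiableAt.differentiableWithinAt
        · rw [interior_Icc]
          intro s hs
          rw [(hd s hs).deriv]
          have h1 := hderiv s hs x B' fun y => ih s (Ioo_subset_Icc_self hs) y
          nlinarith [Real.exp_pos (l * s)]
      have h1 := hanti (left_mem_Icc.mpr hT) ht ht.1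
      simp only [mul_zero, Real.exp_zero, one_mul] at h1
      have h2 : Real.exp (l * t) * (w t x - B') ≤ -B' := h1.trans (by linarith [hinit x])
      have h3 : w t x - B' ≤ -(B' * Real.exp (-(l * t))) := by
        have := mul_le_mul_of_nonneg_left h2 (Real.exp_pos (-(l * t))).le
        rw [← mul_assoc, ← Real.exp_add, neg_add_cancel, Real.exp_zero, one_mul] at this
        linarith
      have h4 : Real.exp (-(l * T)) ≤ Real.exp (-(l * t)) :=
        Real.exp_le_exp.mpr (by nlinarith [ht.2])
      rw [pow_succ, ← mul_assoc]
      change w t x ≤ B' * _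
      nlinarith [mul_le_mul_of_nonneg_left h4 hB']
  have hlim : Tendsto (fun n : ℕ => max B 0 * (1 - Real.exp (-(l * T))) ^ n) atTop (𝓝 0) := by
    simpa using (tendsto_pow_atTop_nhds_zero_of_lt_one hθ0 hθ1).const_mul (max B 0)
  exact ge_of_tendsto' hlim fun n => step n t ht x

/-- Comparison principle for the scheme. -/
theorem le_of_deriv_le_scheme {d : ℕ} {T N h B : ℝ} (hN : 0 ≤ N) (hh : 0 < h)
    {w : ℝ → Sp d → ℝ} {F F' : ℝ → ℝ}
    (hcont : ∀ x, ContinuousOn (fun t => w t x) (Icc 0 T))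
    (hdiff : ∀ t ∈ Ioo 0 T, ∀ x, DifferentiableAt ℝ (fun s => w s x) t)
    (hbdd : ∀ t ∈ Icc 0 T, ∀ x, w t x ≤ B)
    (hF : ∀ t, HasDerivAt F (F' t) t) (hF0 : ∀ t ∈ Icc 0 T, 0 ≤ F t)
    (hinit : ∀ x, w 0 x ≤ F 0)
    (hderiv : ∀ t ∈ Ioo 0 T, ∀ x, deriv (fun s => w s x) t
      ≤ 2 * N * ‖gradH h (w t) x‖ + N * h * lapH h (w t) x + F' t) :
    ∀ t ∈ Icc 0 T, ∀ x, w t x ≤ F t := by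
  have hFc : Continuous F := continuous_iff_continuousAt.mpr fun t => (hF t).continuousAt
  have key := nonpos_of_deriv_le_mul_sub (T := T) (l := 2 * N * d / h) (B := B)
    (w := fun t x => w t x - F t) (by positivity)
    (fun x => (hcont x).sub hFc.continuousOn)
    (fun t ht x => (hdiff t ht x).sub (hF t).differentiableAt)
    (fun t ht x => by linarith [hbdd t ht x, hF0 t ht])
    (fun x => by linarith [hinit x])
    (fun t ht x S hS => by
      rw [((hdiff t ht x).hasDerivAt.fun_sub (hF t)).deriv]
      have h1 := gradH_add_lapH_le hN hh (w := w t) (S := S + F t)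
        (fun y => by linarith [hS y]) x
      have h2 := hderiv t ht x
      have h3 : S + F t - w t x = S - (w t x - F t) := by ring
      rw [h3] at h1
      linarith)
  intro t ht x
  linarith [key t ht x]

end Comparison

/-! ### Regularity of scheme solutions -/

section Regularity

variable {d : ℕ} {T N K : ℝ} {H : ℝ → Sp d → Sp d → ℝ}

/-- The Lipschitz bounds of an admissible Hamiltonian, without convexity. -/
structure HasLipschitzBounds (T N K : ℝ) (H : ℝ → Sp d → Sp d → ℝ) : Prop where
  bound_p : ∀ t ∈ Icc 0 T, ∀ x p p', |H t x p - H t x p'| ≤ 2 * N * ‖p - p'‖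
  bound_t : ∀ s ∈ Icc 0 T, ∀ t ∈ Icc 0 T, ∀ x p, |H t x p - H s x p| ≤ K * (1 + ‖p‖) * |t - s|
  bound_x : ∀ t ∈ Icc 0 T, ∀ x y p, |H t x p - H t y p| ≤ K * (1 + ‖p‖) * ‖x - y‖
  bound_zero : ∀ t ∈ Icc 0 T, ∀ x, |H t x 0| ≤ K

theorem IsAdmissibleHamiltonian.hasLipschitzBounds (hH : IsAdmissibleHamiltonian T N K H) :
    HasLipschitzBounds T N K H :=
  ⟨hH.bound_p, hH.bound_t, hH.bound_x, hH.bound_zero⟩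

/-- `-u` solves the scheme for `-H(t,x,-p)`. This Hamiltonian is concave in `p` when `H` is convex,
but keeps the Lipschitz bounds, so one-sided estimates proved from those bounds alone become
two-sided. -/
theorem HasLipschitzBounds.reflect (hH : HasLipschitzBounds T N K H) :
    HasLipschitzBounds T N K (fun t x p => -H t x (-p)) where
  bound_p t ht x p p' := by
    rw [neg_sub_neg, abs_sub_comm]
    refine (hH.bound_p t ht x _ _).trans (le_of_eq ?_)
    rw [neg_sub_neg, norm_sub_rev]
  bound_t s hs t ht x p := by
    rw [neg_sub_neg, abs_sub_comm]
    simpa using hH.bound_t s hs t ht x (-p)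
  bound_x t ht x y p := by
    rw [neg_sub_neg, abs_sub_comm]
    simpa using hH.bound_x t ht x y (-p)
  bound_zero t ht x := by simpa using hH.bound_zero t ht x

theorem LipOn.abs_sub_le_space {L : ℝ≥0} {u : ℝ → Sp d → ℝ} (hu : LipOn T L u) {t : ℝ}
    (ht : t ∈ Icc 0 T) (x y : Sp d) : |u t x - u t y| ≤ L * ‖x - y‖ := by
  have := hu.dist_le_mul (t, x) ⟨ht, mem_univ _⟩ (t, y) ⟨ht, mem_univ _⟩
  simpa [Prod.dist_eq, Real.dist_eq, dist_eq_norm] using this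

theorem LipOn.abs_sub_le_time {L : ℝ≥0} {u : ℝ → Sp d → ℝ} (hu : LipOn T L u) {s t : ℝ}
    (hs : s ∈ Icc 0 T) (ht : t ∈ Icc 0 T) (x : Sp d) : |u t x - u s x| ≤ L * |t - s| := by
  have := hu.dist_le_mul (t, x) ⟨ht, mem_univ _⟩ (s, x) ⟨hs, mem_univ _⟩
  simpa [Prod.dist_eq, Real.dist_eq] using this

theorem LipOn.continuousOn_time {L : ℝ≥0} {u : ℝ → Sp d → ℝ} (hu : LipOn T L u) (x : Sp d) :
    ContinuousOn (fun t => u t x) (Icc 0 T) :=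
  ContinuousOn.comp (g := fun z : ℝ × Sp d => u z.1 z.2) (f := fun t => (t, x)) hu.continuousOn
    (by fun_prop) fun _ ht => ⟨ht, mem_univ _⟩

theorem LipOn.abs_le {L : ℝ≥0} {u : ℝ → Sp d → ℝ} (hu : LipOn T L u) {q : Sp d → ℝ}
    (hinit : ∀ x, u 0 x = q x) (hq : ∀ x, |q x| ≤ K) {t : ℝ} (ht : t ∈ Icc 0 T) (x : Sp d) :
    |u t x| ≤ K + L * T := by
  have h1 := hu.abs_sub_le_time (left_mem_Icc.mpr (ht.1.trans ht.2)) ht x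
  rw [sub_zero, abs_of_nonneg ht.1, hinit x] at h1
  have h2 := abs_sub_abs_le_abs_sub (u t x) (q x)
  have h3 := mul_le_mul_of_nonneg_left ht.2 L.coe_nonneg
  linarith [hq x]

theorem IsSchemeSolution.reflect {h : ℝ} {q : Sp d → ℝ} {u : ℝ → Sp d → ℝ}
    (hu : IsSchemeSolution T N h H q u) :
    IsSchemeSolution T N h (fun t x p => -H t x (-p)) (fun x => -q x) (fun t x => -u t x) where
  lipschitz := by
    obtain ⟨L, hL⟩ := hu.lipschitz
    exact ⟨L, LipschitzOnWith.of_dist_le_mul fun a ha b hb => by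
      rw [dist_neg_neg]; exact hL.dist_le_mul a ha b hb⟩
  initial x := by rw [hu.initial]
  differentiable t ht x := (hu.differentiable t ht x).fun_neg
  equation t ht x := by
    rw [(hu.differentiable t ht x).hasDerivAt.fun_neg.deriv]
    show _ + -H t x (-gradH h (fun y => -u t y) x) = _ * lapH h (fun y => -u t y) x
    rw [gradH_neg, lapH_neg, neg_neg]
    linarith [hu.equation t ht x]

variable {h : ℝ} {q : Sp d → ℝ} {u : ℝ → Sp d → ℝ}

theorem IsSchemeSolution.le_bound (hH : HasLipschitzBounds T N K H) (hN : 0 ≤ N) (hK : 0 ≤ K)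
    (hh : 0 < h) (hq : ∀ x, |q x| ≤ K) (hu : IsSchemeSolution T N h H q u) {t : ℝ}
    (ht : t ∈ Icc 0 T) (x : Sp d) : u t x ≤ K + K * T := by
  obtain ⟨L, hL⟩ := hu.lipschitz
  have := le_of_deriv_le_scheme (T := T) (B := K + L * T) hN hh (w := u)
    (F := fun t => K + K * t) (F' := fun _ => K)
    hL.continuousOn_time hu.differentiable
    (fun t ht x => (le_abs_self _).trans (hL.abs_le hu.initial hq ht x))
    (fun t => by simpa using ((hasDerivAt_id t).const_mul K).const_add K)
    (fun t ht => by have := ht.1; positivity)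
    (fun x => by rw [hu.initial]; simpa using (le_abs_self _).trans (hq x))
    (fun t ht x => by
      have h1 := hu.equation t ht x
      have ht' := Ioo_subset_Icc_self ht
      have h2 := (abs_le.mp (hH.bound_p t ht' x (gradH h (u t) x) 0)).1
      rw [sub_zero] at h2
      have h3 := (abs_le.mp (hH.bound_zero t ht' x)).1
      linarith) t ht x
  have h1 : K * t ≤ K * T := mul_le_mul_of_nonneg_left ht.2 hK
  linarith

theorem IsSchemeSolution.abs_le_bound (hH : HasLipschitzBounds T N K H) (hN : 0 ≤ N) (hK : 0 ≤ K)
    (hh : 0 < h) (hq : ∀ x, |q x| ≤ K) (hu : IsSchemeSolution T N h H q u) {t : ℝ}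
    (ht : t ∈ Icc 0 T) (x : Sp d) : |u t x| ≤ K + K * T := by
  have h1 := hu.reflect.le_bound hH.reflect hN hK hh (fun x => by simpa using hq x) ht x
  exact abs_le.mpr ⟨by linarith, hu.le_bound hH hN hK hh hq ht x⟩

/-- Spatial Lipschitz constant of scheme solutions, uniform in the mesh size. -/
noncomputable def schemeLip (d : ℕ) (T K : ℝ) : ℝ :=
  2 * (K + K * T) * Real.exp ((2 * K * d + 1) * T)

theorem schemeLip_nonneg (d : ℕ) (hT : 0 ≤ T) (hK : 0 ≤ K) : 0 ≤ schemeLip d T K := by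
  unfold schemeLip; positivity

/-- The translate difference `u(t,x+z) - u(t,x)` satisfies the scheme inequality with source `K(1 +
|∇ʰu|)|z|`. The assumed Lipschitz bound controls this source, and integrating it in time halves the
contribution of `Θ`. -/
theorem IsSchemeSolution.lipschitz_improve (hH : HasLipschitzBounds T N K H) (hN : 0 ≤ N)
    (hK : 0 ≤ K) (hh : 0 < h) (hq : ∀ x, |q x| ≤ K) (hqL : ∀ x y, |q x - q y| ≤ K * ‖x - y‖)
    (hu : IsSchemeSolution T N h H q u) {Θ : ℝ} (hΘ : 0 ≤ Θ)
    (hbd : ∀ t ∈ Icc 0 T, ∀ x y,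
      |u t x - u t y| ≤ Θ * Real.exp ((2 * K * d + 1) * t) * ‖x - y‖) :
    ∀ t ∈ Icc 0 T, ∀ x y,
      |u t x - u t y| ≤ (K + K * T + Θ / 2) * Real.exp ((2 * K * d + 1) * t) * ‖x - y‖ := by
  set b := 2 * K * d + 1 with hb
  have hb0 : 0 < b := by positivity
  obtain ⟨L, hL⟩ := hu.lipschitz
  suffices key : ∀ z, ∀ t ∈ Icc 0 T, ∀ x, u t (x + z) - u t x
      ≤ (K + K * T + Θ / 2) * Real.exp (b * t) * ‖z‖ by
    intro t ht x y
    have h1 := key (x - y) t ht y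
    have h2 := key (y - x) t ht x
    rw [add_sub_cancel] at h1 h2
    rw [norm_sub_rev y x] at h2
    exact abs_le.mpr ⟨by linarith, h1⟩
  intro z t ht x
  have hT : 0 ≤ T := ht.1.trans ht.2
  have := le_of_deriv_le_scheme (T := T) (B := (K + L * T) + (K + L * T)) hN hh
    (w := fun t x => u t (x + z) - u t x)
    (F := fun t => ‖z‖ * (K + (K * t + K * d * Θ / b * Real.exp (b * t))))
    (F' := fun t => ‖z‖ * (K + K * d * Θ * Real.exp (b * t)))
    (fun x => (hL.continuousOn_time _).sub (hL.continuousOn_time x))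
    (fun t ht x => (hu.differentiable t ht _).sub (hu.differentiable t ht x))
    (fun t ht x => by
      have h1 := (abs_le.mp (hL.abs_le hu.initial hq ht (x + z))).2
      have h2 := (abs_le.mp (hL.abs_le hu.initial hq ht x)).1
      linarith)
    (fun t => by
      have h1 : HasDerivAt (fun t => Real.exp (b * t)) (Real.exp (b * t) * b) t := by
        simpa using ((hasDerivAt_id t).const_mul b).exp
      have h2 := ((((hasDerivAt_id' t).const_mul K).fun_add
        (h1.const_mul (K * d * Θ / b))).const_add K).const_mul ‖z‖
      refine h2.congr_deriv ?_
      field_simp)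
    (fun t ht => by have := ht.1; positivity)
    (fun x => by
      rw [hu.initial, hu.initial]
      have h1 := (le_abs_self _).trans (hqL (x + z) x)
      rw [add_sub_cancel_left] at h1
      refine h1.trans ?_
      have : 0 ≤ K * d * Θ / b := by positivity
      simp only [mul_zero, Real.exp_zero]
      nlinarith [norm_nonneg z])
    (fun t ht x => by
      have ht' := Ioo_subset_Icc_self ht
      rw [((hu.differentiable t ht (x + z)).hasDerivAt.fun_sub
        (hu.differentiable t ht x).hasDerivAt).deriv, gradH_sub, lapH_sub, gradH_comp_add,
        lapH_comp_add]
      have h1 := hu.equation t ht x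
      have h2 := hu.equation t ht (x + z)
      have h3 := (abs_le.mp (hH.bound_p t ht' (x + z) (gradH h (u t) (x + z))
        (gradH h (u t) x))).1
      have h4 := (abs_le.mp (hH.bound_x t ht' (x + z) x (gradH h (u t) x))).1
      rw [add_sub_cancel_left] at h4
      have h5 := norm_gradH_le_of_lipschitz hh (hbd t ht') x
      have h6 : K * (1 + ‖gradH h (u t) x‖) * ‖z‖
          ≤ ‖z‖ * (K + K * d * Θ * Real.exp (b * t)) := by
        have : K * (1 + ‖gradH h (u t) x‖) ≤ K * (1 + d * (Θ * Real.exp (b * t))) := by gcongr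
        nlinarith [norm_nonneg z]
      linarith) t ht x
  refine this.trans ?_
  have h1 : 1 ≤ Real.exp (b * t) := Real.one_le_exp (mul_nonneg hb0.le ht.1)
  -- The growth rate `b = 2Kd + 1` is chosen for this inequality.
  have h2 : K * d * Θ / b ≤ Θ / 2 := by
    rw [div_le_div_iff₀ hb0 two_pos, hb]
    nlinarith
  have h3 : K + (K * t + K * d * Θ / b * Real.exp (b * t))
      ≤ (K + K * T + Θ / 2) * Real.exp (b * t) := by
    have h4 : K * t ≤ K * T := mul_le_mul_of_nonneg_left ht.2 hK
    have h5 : K + K * T ≤ (K + K * T) * Real.exp (b * t) :=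
      le_mul_of_one_le_right (by positivity) h1
    have h6 := mul_le_mul_of_nonneg_right h2 (Real.exp_pos (b * t)).le
    linarith
  rw [mul_comm _ ‖z‖]
  exact mul_le_mul_of_nonneg_left h3 (norm_nonneg z)

/-- The unquantified Lipschitz constant `L` of the solution only starts the iteration of `Θ ↦ K + KT
+ Θ/2`; the fixed point `2(K + KT)` forgets it. -/
theorem IsSchemeSolution.abs_sub_le (hH : HasLipschitzBounds T N K H) (hN : 0 ≤ N)
    (hK : 0 ≤ K) (hh : 0 < h) (hq : ∀ x, |q x| ≤ K) (hqL : ∀ x y, |q x - q y| ≤ K * ‖x - y‖)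
    (hu : IsSchemeSolution T N h H q u) {t : ℝ} (ht : t ∈ Icc 0 T) (x y : Sp d) :
    |u t x - u t y| ≤ schemeLip d T K * ‖x - y‖ := by
  obtain ⟨L, hL⟩ := hu.lipschitz
  have hT : 0 ≤ T := ht.1.trans ht.2
  have hA : 0 ≤ 2 * (K + K * T) := by positivity
  have step : ∀ n : ℕ, ∀ t ∈ Icc 0 T, ∀ x y, |u t x - u t y|
      ≤ (2 * (K + K * T) + L * (1 / 2) ^ n) * Real.exp ((2 * K * d + 1) * t) * ‖x - y‖ := by
    intro n
    induction n with
    | zero =>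
      intro t ht x y
      refine (hL.abs_sub_le_space ht x y).trans (mul_le_mul_of_nonneg_right ?_ (norm_nonneg _))
      have h1 : 1 ≤ Real.exp ((2 * K * d + 1) * t) :=
        Real.one_le_exp (mul_nonneg (by positivity) ht.1)
      have := L.coe_nonneg
      rw [pow_zero, mul_one]
      nlinarith
    | succ n ih =>
      intro t ht x y
      refine (hu.lipschitz_improve hH hN hK hh hq hqL (by positivity) ih t ht x y).trans
        (le_of_eq ?_)
      rw [pow_succ]
      ring
  have hlim : Tendsto (fun n : ℕ => (2 * (K + K * T) + L * (1 / 2) ^ n)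
      * Real.exp ((2 * K * d + 1) * t) * ‖x - y‖) atTop
      (𝓝 ((2 * (K + K * T) + L * 0) * Real.exp ((2 * K * d + 1) * t) * ‖x - y‖)) :=
    (((tendsto_pow_atTop_nhds_zero_of_lt_one (by norm_num) (by norm_num)).const_mul
      (L : ℝ)).const_add _).mul_const _ |>.mul_const _
  refine (ge_of_tendsto' hlim fun n => step n t ht x y).trans ?_
  rw [mul_zero, add_zero, schemeLip]
  have := ht.2
  gcongr

end Regularity

/-! ### Policy iteration -/

section PolicyIteration

variable {d : ℕ} {T N h : ℝ} {K : ℝ≥0} {H : ℝ → Sp d → Sp d → ℝ} {q : Sp d → ℝ}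
  {α : ℝ → Sp d → Sp d → Sp d} {u : ℝ → Sp d → ℝ} {v : ℕ → ℝ → Sp d → ℝ}

theorem IsSubgradient.norm_le {F : Sp d → ℝ} {p μ : Sp d} {M : ℝ} (hM : 0 ≤ M)
    (hμ : IsSubgradient F p μ) (hF : ∀ p p', |F p - F p'| ≤ M * ‖p - p'‖) : ‖μ‖ ≤ M := by
  -- In the direction `μ` itself the subgradient inequality reads `|μ|² ≤ M|μ|`.
  have h1 := hμ (p + μ)
  have h2 := (abs_le.mp (hF (p + μ) p)).2
  rw [add_sub_cancel_left] at h1 h2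
  rw [real_inner_self_eq_norm_sq] at h1
  by_contra! hlt
  nlinarith [hM.trans_lt hlt]

/-- The error of one policy update solves the scheme up to the gradient of the previous error. -/
theorem IsLinearizedSolution.abs_deriv_sub_le (hN : 0 ≤ N) (hH : HasLipschitzBounds T N K H)
    (hα : IsPolicyMap T H α) (hu : IsSchemeSolution T N h H q u) {v₀ v₁ : ℝ → Sp d → ℝ}
    (hv : IsLinearizedSolution T N h H q (fun t x => α t x (gradH h (v₀ t) x)) v₁)
    {t : ℝ} (ht : t ∈ Ioo 0 T) (x : Sp d) :
    |deriv (fun s => v₁ s x - u s x) t - N * h * lapH h (fun y => v₁ t y - u t y) x|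
      ≤ 2 * N * ‖gradH h (fun y => v₁ t y - u t y) x‖
        + 4 * N * ‖gradH h (fun y => v₀ t y - u t y) x‖ := by
  have ht' := Ioo_subset_Icc_self ht
  have e1 := hu.equation t ht x
  have e2 := hv.equation t ht x
  have hsub := hα t ht' x (gradH h (v₀ t) x)
  have hμ := hsub.norm_le (by positivity : 0 ≤ 2 * N) (hH.bound_p t ht' x)
  rw [((hv.differentiable t ht x).hasDerivAt.fun_sub (hu.differentiable t ht x).hasDerivAt).deriv,
    lapH_sub, gradH_sub, gradH_sub]
  -- With `L(μ) = p₀·μ - H(p₀)`, the quantity to estimate is `-μ·(p₁ - p) + μ·(p₀ - p) - (H(p₀) -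
  -- H(p))`, each term carrying the factor `2N`.
  simp only [legendre_eq_of_isSubgradient hsub] at e2
  generalize α t x (gradH h (v₀ t) x) = μ at *
  generalize gradH h (v₀ t) x = p₀ at *
  generalize gradH h (v₁ t) x = p₁ at *
  generalize gradH h (u t) x = p at *
  have h1 : |inner ℝ μ (p₁ - p)| ≤ 2 * N * ‖p₁ - p‖ :=
    (abs_real_inner_le_norm _ _).trans (mul_le_mul_of_nonneg_right hμ (norm_nonneg _))
  have h2 : |inner ℝ μ (p₀ - p)| ≤ 2 * N * ‖p₀ - p‖ :=
    (abs_real_inner_le_norm _ _).trans (mul_le_mul_of_nonneg_right hμ (norm_nonneg _))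
  have h3 := hH.bound_p t ht' x p₀ p
  rw [inner_sub_right] at h1 h2
  rw [real_inner_comm] at e2
  rw [real_inner_comm μ p₀] at e2
  rw [real_inner_comm μ p₁] at e2
  rw [abs_le] at h1 h2 h3 ⊢
  constructor <;> linarith

theorem abs_le_of_abs_deriv_sub_le {B : ℝ} (hN : 0 ≤ N) (hh : 0 < h)
    {w : ℝ → Sp d → ℝ} {F F' : ℝ → ℝ}
    (hcont : ∀ x, ContinuousOn (fun t => w t x) (Icc 0 T))
    (hdiff : ∀ t ∈ Ioo 0 T, ∀ x, DifferentiableAt ℝ (fun s => w s x) t)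
    (hbdd : ∀ t ∈ Icc 0 T, ∀ x, |w t x| ≤ B)
    (hF : ∀ t, HasDerivAt F (F' t) t) (hF0 : ∀ t ∈ Icc 0 T, 0 ≤ F t)
    (hinit : ∀ x, |w 0 x| ≤ F 0)
    (hderiv : ∀ t ∈ Ioo 0 T, ∀ x, |deriv (fun s => w s x) t - N * h * lapH h (w t) x|
      ≤ 2 * N * ‖gradH h (w t) x‖ + F' t) :
    ∀ t ∈ Icc 0 T, ∀ x, |w t x| ≤ F t := by
  have h1 := le_of_deriv_le_scheme hN hh hcont hdiff (fun t ht x => (abs_le.mp (hbdd t ht x)).2)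
    hF hF0 (fun x => (abs_le.mp (hinit x)).2)
    (fun t ht x => by linarith [(abs_le.mp (hderiv t ht x)).2])
  have h2 := le_of_deriv_le_scheme (w := fun t x => -w t x) (B := B) hN hh
    (fun x => (hcont x).neg) (fun t ht x => (hdiff t ht x).fun_neg)
    (fun t ht x => by linarith [(abs_le.mp (hbdd t ht x)).1])
    hF hF0 (fun x => by linarith [(abs_le.mp (hinit x)).1])
    (fun t ht x => by
      rw [(hdiff t ht x).hasDerivAt.fun_neg.deriv, gradH_neg, lapH_neg, norm_neg]
      linarith [(abs_le.mp (hderiv t ht x)).1])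
  exact fun t ht x => abs_le.mpr ⟨by linarith [h2 t ht x], h1 t ht x⟩

/-- Factor controlling the error of the first policy update. -/
noncomputable def policyConst (d : ℕ) (T N K : ℝ) : ℝ := 4 * N * (d * (K + schemeLip d T K))

theorem norm_gradH_start_sub_le (hN : 0 ≤ N) (hh : 0 < h) (hH : HasLipschitzBounds T N K H)
    (hq : ∀ x, |q x| ≤ K) (hqL : LipschitzWith K q) (hu : IsSchemeSolution T N h H q u)
    (hv : IsPolicyIteration T N K h H α q v) {t : ℝ} (ht : t ∈ Icc 0 T) (x : Sp d) :
    ‖gradH h (fun y => v 0 t y - u t y) x‖ ≤ d * (K + schemeLip d T K) := by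
  refine norm_gradH_le_of_lipschitz hh (fun y z => ?_) x
  have h1 := hv.start_lipschitz.abs_sub_le_space ht y z
  have h2 := hu.abs_sub_le hH hN K.coe_nonneg hh hq
    (fun x y => by simpa [Real.dist_eq, dist_eq_norm] using hqL.dist_le_mul x y) ht y z
  rw [abs_le] at h1 h2 ⊢
  constructor <;> linarith

/-- A Picard iteration: each update integrates in time `4N` times the previous discrete gradient,
hence at most `4Nd/h` times the previous error. For the first update the Lipschitz bounds on `v 0`
and `u` replace the factor `1/h`. -/
theorem IsPolicyIteration.abs_sub_le (hN : 0 ≤ N) (hT : 0 ≤ T) (hh : 0 < h)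
    (hH : HasLipschitzBounds T N K H) (hq : ∀ x, |q x| ≤ K) (hqL : LipschitzWith K q)
    (hα : IsPolicyMap T H α) (hu : IsSchemeSolution T N h H q u)
    (hv : IsPolicyIteration T N K h H α q v) (n : ℕ) :
    ∀ t ∈ Icc 0 T, ∀ x, |v (n + 1) t x - u t x|
      ≤ policyConst d T N K * (4 * N * d / h) ^ n * (t ^ (n + 1) / (n + 1).factorial) := by
  obtain ⟨Lu, hLu⟩ := hu.lipschitz
  have hA : 0 ≤ policyConst d T N K := by
    have := schemeLip_nonneg d hT K.coe_nonneg
    unfold policyConst; positivity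
  have hF : ∀ (n : ℕ) (A t : ℝ), HasDerivAt (fun t : ℝ => A * (t ^ (n + 1) / (n + 1).factorial))
      (A * (t ^ n / n.factorial)) t := by
    intro n A t
    refine (((hasDerivAt_pow (n + 1) t).div_const _).const_mul A).congr_deriv ?_
    rw [Nat.factorial_succ]
    push_cast
    field_simp
  have main : ∀ n, (∀ t ∈ Ioo 0 T, ∀ x, 4 * N * ‖gradH h (fun y => v n t y - u t y) x‖
      ≤ policyConst d T N K * (4 * N * d / h) ^ n * (t ^ n / n.factorial)) →
      ∀ t ∈ Icc 0 T, ∀ x, |v (n + 1) t x - u t x|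
      ≤ policyConst d T N K * (4 * N * d / h) ^ n * (t ^ (n + 1) / (n + 1).factorial) := by
    intro n hn
    obtain ⟨Lv, hLv⟩ := (hv.step n).lipschitz
    refine abs_le_of_abs_deriv_sub_le (w := fun t x => v (n + 1) t x - u t x)
      (B := (K + Lv * T) + (K + Lu * T)) hN hh
      (fun x => (hLv.continuousOn_time x).sub (hLu.continuousOn_time x))
      (fun t ht x => ((hv.step n).differentiable t ht x).sub (hu.differentiable t ht x))
      (fun t ht x => (abs_sub _ _).trans (add_le_add (hLv.abs_le (hv.step n).initial hq ht x)
        (hLu.abs_le hu.initial hq ht x)))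
      (hF n _) (fun t ht => by have := ht.1; positivity)
      (fun x => by simp [(hv.step n).initial, hu.initial]) (fun t ht x => ?_)
    exact ((hv.step n).abs_deriv_sub_le hN hH hα hu ht x).trans (by linarith [hn t ht x])
  induction n with
  | zero =>
    refine main 0 fun t ht x => ?_
    have := norm_gradH_start_sub_le hN hh hH hq hqL hu hv (Ioo_subset_Icc_self ht) x
    simpa [policyConst] using mul_le_mul_of_nonneg_left this (by positivity : 0 ≤ 4 * N)
  | succ n ih =>
    refine main (n + 1) fun t ht x => ?_
    have := norm_gradH_le_of_abs_le hh (ih t (Ioo_subset_Icc_self ht)) x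
    refine (mul_le_mul_of_nonneg_left this (by positivity : 0 ≤ 4 * N)).trans (le_of_eq ?_)
    rw [pow_succ (4 * N * d / h)]
    ring

/-- Geometric decay of the error of policy iteration, in the sup norm. -/
theorem IsPolicyIteration.sq_abs_sub_le (hN : 0 ≤ N) (hT : 0 ≤ T) (hh : 0 < h)
    (hH : HasLipschitzBounds T N K H) (hq : ∀ x, |q x| ≤ K) (hqL : LipschitzWith K q)
    (hα : IsPolicyMap T H α) (hu : IsSchemeSolution T N h H q u)
    (hv : IsPolicyIteration T N K h H α q v) {n : ℕ} (hn : 1 ≤ n) {t : ℝ} (ht : t ∈ Icc 0 T)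
    (x : Sp d) :
    |v n t x - u t x| ^ 2 ≤ 2 * policyConst d T N K ^ 2 * T * (2 ^ n)⁻¹ * h
      * Real.exp ((16 * N * d + 1) * t / h) := by
  obtain ⟨m, rfl⟩ := Nat.exists_eq_add_of_le' hn
  have hA : 0 ≤ policyConst d T N K := by
    have := schemeLip_nonneg d hT K.coe_nonneg
    unfold policyConst; positivity
  have ht0 := ht.1
  set A := policyConst d T N K
  set c := 4 * N * d / h with hc
  have hc0 : 0 ≤ c := by positivity
  have h1 : |v (m + 1) t x - u t x| ≤ A * t * ((1 / 2) ^ m * Real.exp (2 * c * t)) := by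
    refine (hv.abs_sub_le hN hT hh hH hq hqL hα hu m t ht x).trans ?_
    have h2 := Real.pow_div_factorial_le_exp (2 * c * t) (by positivity) m
    -- Comparing with the exponential at `2ct` rather than `ct` leaves the spare factor `2⁻ᵐ`.
    have h3 : (c * t) ^ m / m.factorial ≤ (1 / 2) ^ m * Real.exp (2 * c * t) := by
      have h4 := mul_le_mul_of_nonneg_left h2 (by positivity : (0 : ℝ) ≤ (1 / 2) ^ m)
      rwa [← mul_div_assoc, ← mul_pow, show 1 / 2 * (2 * c * t) = c * t by ring] at h4
    have h5 : ((m + 1).factorial : ℝ)⁻¹ ≤ (m.factorial : ℝ)⁻¹ :=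
      inv_anti₀ (by positivity) (by exact_mod_cast Nat.factorial_le (Nat.le_succ m))
    calc A * c ^ m * (t ^ (m + 1) / (m + 1).factorial)
        = A * t * ((c * t) ^ m * ((m + 1).factorial : ℝ)⁻¹) := by
          rw [mul_pow, pow_succ]; ring
      _ ≤ A * t * ((c * t) ^ m * (m.factorial : ℝ)⁻¹) := by gcongr
      _ ≤ _ := by rw [← div_eq_mul_inv]; gcongr
  have h2 : |v (m + 1) t x - u t x| ^ 2
      ≤ A ^ 2 * (t * t) * ((1 / 2) ^ m * ((1 / 2) ^ m * Real.exp (4 * c * t))) := by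
    refine (pow_le_pow_left₀ (abs_nonneg _) h1 2).trans (le_of_eq ?_)
    rw [show 4 * c * t = 2 * c * t + 2 * c * t by ring, Real.exp_add]
    ring
  -- The factor `h` of the estimate comes from here: of the `t²` in the squared bound, one `t` is
  -- bounded by `T`, the other by `h exp(t/h)`.
  have h3 : t ≤ h * Real.exp (t / h) := by
    have := Real.add_one_le_exp (t / h)
    have h4 : t = h * (t / h) := by field_simp
    nlinarith
  -- Squaring produced `2⁻ᵐ` twice; one copy suffices, and `2⁻ᵐ = 2 · 2⁻⁽ᵐ⁺¹⁾` explains the constant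
  -- `2`.
  have h4 : ((1 : ℝ) / 2) ^ m ≤ 1 := pow_le_one₀ (by norm_num) (by norm_num)
  calc _ ≤ _ := h2
    _ ≤ A ^ 2 * (T * (h * Real.exp (t / h))) * ((1 / 2) ^ m * (1 * Real.exp (4 * c * t))) := by
        have := ht.2
        gcongr
    _ = 2 * A ^ 2 * T * (2 ^ (m + 1))⁻¹ * h * (Real.exp (4 * c * t) * Real.exp (t / h)) := by
        rw [pow_succ 2 m, one_div, inv_pow, mul_inv]; ring
    _ = _ := by
        rw [← Real.exp_add, hc]
        congr 2
        ring

/-- No measurability of `f` is needed, since a non-integrable function has integral zero by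
convention. This matters for the policies, which are arbitrary selections of subgradients. -/
theorem setIntegral_ball_le {f : Sp d → ℝ} {D R : ℝ} (hf : ∀ x, |f x| ≤ D)
    (hR : 0 < R) : ∫ x in Metric.ball (0 : Sp d) R, f x
      ≤ D * volume.real (Metric.ball (0 : Sp d) 1) * R ^ d := by
  have h1 := norm_setIntegral_le_of_norm_le_const (μ := volume) (s := Metric.ball (0 : Sp d) R)
    measure_ball_lt_top (f := f) fun x _ => hf x
  have h2 : volume.real (Metric.ball (0 : Sp d) R)
      = R ^ d * volume.real (Metric.ball (0 : Sp d) 1) := by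
    rw [Measure.real, Measure.addHaar_ball_of_pos volume (0 : Sp d) hR, finrank_euclideanSpace_fin,
      ENNReal.toReal_mul, ENNReal.toReal_ofReal (by positivity), Measure.real]
  rw [h2] at h1
  refine ((le_abs_self _).trans h1).trans (le_of_eq (by ring))

end PolicyIteration

/-! ### Convergence to the viscosity solution -/

section Viscosity

variable {d : ℕ} {T N K h : ℝ} {H : ℝ → Sp d → Sp d → ℝ} {q : Sp d → ℝ} {u : ℝ → Sp d → ℝ}

/-- By the equation, `∂ₜu(·,x)` is Lipschitz in time. The constant `c` may blow up as `h → 0`: it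
only serves to replace `u(·,x₀)` by a smooth parabola in a test function for `v`, and disappears on
differentiating at `t₀`. -/
theorem IsSchemeSolution.exists_quadratic_le (hH : HasLipschitzBounds T N K H) (hN : 0 ≤ N)
    (hK : 0 ≤ K) (hh : 0 < h) (hu : IsSchemeSolution T N h H q u) {t₀ : ℝ} (ht₀ : t₀ ∈ Ioo 0 T)
    (x : Sp d) : ∃ c : ℝ, ∀ t ∈ Ioo 0 T,
      u t₀ x + deriv (fun s => u s x) t₀ * (t - t₀) - c * (t - t₀) ^ 2 ≤ u t x := by
  obtain ⟨L, hL⟩ := hu.lipschitz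
  have hL0 := L.coe_nonneg
  set g : ℝ → ℝ := deriv fun s => u s x with hg
  set c : ℝ := N * h * (d * (4 * L / h ^ 2)) + 2 * N * (d * L / h) + K * (1 + d * L) with hc
  have hc0 : 0 ≤ c := by positivity
  have hglip : ∀ s ∈ Ioo 0 T, |g s - g t₀| ≤ c * |s - t₀| := by
    intro s hs
    have hs' := Ioo_subset_Icc_self hs
    have ht₀' := Ioo_subset_Icc_self ht₀
    have e1 := hu.equation s hs x
    have e2 := hu.equation t₀ ht₀ x
    have h1 := abs_lapH_le_of_abs_le hh (fun y => hL.abs_sub_le_time ht₀' hs' y) x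
    have h2 := norm_gradH_le_of_abs_le hh (fun y => hL.abs_sub_le_time ht₀' hs' y) x
    have h3 := norm_gradH_le_of_lipschitz hh (hL.abs_sub_le_space ht₀') x
    rw [lapH_sub] at h1
    rw [gradH_sub] at h2
    have h4 := hH.bound_p s hs' x (gradH h (u s) x) (gradH h (u t₀) x)
    have h5 := hH.bound_t t₀ ht₀' s hs' x (gradH h (u t₀) x)
    have h6 : 2 * N * ‖gradH h (u s) x - gradH h (u t₀) x‖ ≤ 2 * N * (d * (L * |s - t₀|) / h) := by
      gcongr
    have h7 : K * (1 + ‖gradH h (u t₀) x‖) * |s - t₀| ≤ K * (1 + d * L) * |s - t₀| := by gcongr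
    have h8 : |N * h * (lapH h (u s) x - lapH h (u t₀) x)|
        ≤ N * h * (d * (4 * (L * |s - t₀|) / h ^ 2)) := by
      rw [abs_mul, abs_of_nonneg (by positivity : 0 ≤ N * h)]
      gcongr
    have h9 : c * |s - t₀| = N * h * (d * (4 * (L * |s - t₀|) / h ^ 2))
        + 2 * N * (d * (L * |s - t₀|) / h) + K * (1 + d * L) * |s - t₀| := by
      rw [hc]; ring
    have h10 : g s - g t₀ = N * h * (lapH h (u s) x - lapH h (u t₀) x)
        - (H s x (gradH h (u s) x) - H s x (gradH h (u t₀) x))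
        - (H s x (gradH h (u t₀) x) - H t₀ x (gradH h (u t₀) x)) := by
      rw [hg]; linarith
    rw [h9, h10]
    rw [abs_le] at h4 h5 h8 ⊢
    constructor <;> linarith
  refine ⟨c, fun t ht => ?_⟩
  have hsub : uIcc t₀ t ⊆ Ioo 0 T := (ordConnected_Ioo).uIcc_subset ht₀ ht
  have hd : ∀ s ∈ uIcc t₀ t,
      HasDerivWithinAt (fun s => u s x - g t₀ * s) (g s - g t₀) (uIcc t₀ t) s := by
    intro s hs
    have h1 := (hu.differentiable s (hsub hs) x).hasDerivAt.fun_sub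
      ((hasDerivAt_id' s).const_mul (g t₀))
    rw [mul_one] at h1
    exact h1.hasDerivWithinAt
  have h1 := (convex_uIcc t₀ t).norm_image_sub_le_of_norm_hasDerivWithin_le hd
    (C := c * |t - t₀|) (fun s hs => (hglip s (hsub hs)).trans
      (mul_le_mul_of_nonneg_left (abs_sub_left_of_mem_uIcc hs) hc0)) left_mem_uIcc right_mem_uIcc
  have h2 := (abs_le.mp h1).1
  rw [Real.norm_eq_abs, mul_assoc, ← sq, sq_abs] at h2
  linarith

/-- Monotonicity at a maximum of `u - k|· - y₀|²` has right side zero, so the quadratic may replace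
`u` in the scheme, and its discrete derivatives are explicit. -/
theorem IsSchemeSolution.deriv_le_of_touching (hH : HasLipschitzBounds T N K H) (hN : 0 ≤ N)
    (hh : 0 < h) (hu : IsSchemeSolution T N h H q u) {t₀ k : ℝ} (ht₀ : t₀ ∈ Ioo 0 T) {x₀ y₀ : Sp d}
    (hmax : ∀ x, u t₀ x - k * ‖x - y₀‖ ^ 2 ≤ u t₀ x₀ - k * ‖x₀ - y₀‖ ^ 2) :
    deriv (fun s => u s x₀) t₀ ≤ N * h * (2 * k * d) - H t₀ x₀ ((2 * k) • (x₀ - y₀)) := by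
  have h1 := gradH_add_lapH_le hN hh hmax x₀
  rw [sub_self, mul_zero, gradH_sub, lapH_sub, gradH_norm_sub_sq hh.ne', lapH_norm_sub_sq hh.ne']
    at h1
  have h2 := hu.equation t₀ ht₀ x₀
  have h3 := (abs_le.mp (hH.bound_p t₀ (Ioo_subset_Icc_self ht₀) x₀ (gradH h (u t₀) x₀)
    ((2 * k) • (x₀ - y₀)))).1
  linarith

theorem hasGradientAt_norm_sub_sq (x₀ y : Sp d) :
    HasGradientAt (fun y => ‖y - x₀‖ ^ 2) ((2 : ℝ) • (y - x₀)) y := by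
  rw [hasGradientAt_iff_hasFDerivAt]
  refine ((hasFDerivAt_id y).sub_const x₀).norm_sq.congr_fderiv ?_
  ext z
  simp

theorem supersolution_quadratic {v : ℝ → Sp d → ℝ}
    (hsuper : ∀ φ : ℝ × Sp d → ℝ, ContDiff ℝ 1 φ → ∀ t ∈ Ioo 0 T, ∀ x,
      IsLocalMin (fun z : ℝ × Sp d => v z.1 z.2 - φ z) (t, x) →
        0 ≤ deriv (fun s => φ (s, x)) t + H t x (gradient (fun y => φ (t, y)) x))
    {a m k δ t₀ : ℝ} {x₀ y₀ : Sp d} (ht₀ : t₀ ∈ Ioo 0 T)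
    (hmin : IsLocalMin (fun z : ℝ × Sp d => v z.1 z.2 - (a * (z.1 - t₀) - m * (z.1 - t₀) ^ 2
      - k * ‖z.2 - x₀‖ ^ 2 - δ * ‖z.2‖ ^ 2)) (t₀, y₀)) :
    0 ≤ a + H t₀ y₀ ((2 * k) • (x₀ - y₀) - (2 * δ) • y₀) := by
  have hsmooth : ContDiff ℝ 1 (fun z : ℝ × Sp d => a * (z.1 - t₀) - m * (z.1 - t₀) ^ 2
      - k * ‖z.2 - x₀‖ ^ 2 - δ * ‖z.2‖ ^ 2) := by
    have h1 : ContDiff ℝ 1 fun z : ℝ × Sp d => ‖z.2 - x₀‖ ^ 2 :=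
      (contDiff_snd.sub contDiff_const).norm_sq ℝ
    have h2 : ContDiff ℝ 1 fun z : ℝ × Sp d => ‖z.2‖ ^ 2 := contDiff_snd.norm_sq ℝ
    fun_prop
  have h1 := hsuper _ hsmooth t₀ ht₀ y₀ hmin
  have h2 : HasDerivAt (fun s => a * (s - t₀) - m * (s - t₀) ^ 2
      - k * ‖y₀ - x₀‖ ^ 2 - δ * ‖y₀‖ ^ 2) a t₀ := by
    have h3 := (hasDerivAt_id' t₀).sub_const t₀
    refine ((((h3.const_mul a).fun_sub ((h3.fun_pow 2).const_mul m)).sub_const _).sub_const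
      _).congr_deriv ?_
    simp
  have h3 : HasGradientAt (fun y => a * (t₀ - t₀) - m * (t₀ - t₀) ^ 2
      - k * ‖y - x₀‖ ^ 2 - δ * ‖y‖ ^ 2) ((2 * k) • (x₀ - y₀) - (2 * δ) • y₀) y₀ := by
    have h4 := (hasGradientAt_norm_sub_sq x₀ y₀).hasFDerivAt
    have h5 := (hasGradientAt_norm_sub_sq 0 y₀).hasFDerivAt
    simp only [sub_zero] at h5
    rw [hasGradientAt_iff_hasFDerivAt]
    refine (((h4.const_mul k).const_sub _).fun_sub (h5.const_mul δ)).congr_fderiv ?_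
    rw [← map_smul, ← map_smul, ← map_neg, ← map_sub]
    congr 1
    module
  simp only at h1
  rwa [h2.deriv, h3.gradient] at h1

/-- The tangent parabola bounds the squared positive part from above, so the time penalty can enter
a test function as a polynomial. -/
theorem sq_posPart_le (a b : ℝ) :
    max b 0 ^ 2 ≤ max a 0 ^ 2 + 2 * max a 0 * (b - a) + (b - a) ^ 2 := by
  rcases max_cases a 0 with ⟨h1, h2⟩ | ⟨h1, h2⟩ <;>
    rcases max_cases b 0 with ⟨h3, h4⟩ | ⟨h3, h4⟩ <;> rw [h1, h3] <;> nlinarith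

/-- Rate of convergence factor, per unit time, of the scheme. -/
noncomputable def viscosityConst (d : ℕ) (T N K : ℝ) : ℝ :=
  N * d + K * (1 + 2 * schemeLip d T K) * (2 * schemeLip d T K) + 1

theorem exists_pos_mul_lt_mul_lt {a b γ η : ℝ} (ha : 0 ≤ a) (hb : 0 ≤ b) (hγ : 0 < γ)
    (hη : 0 < η) : ∃ δ : ℝ, 0 < δ ∧ δ * a < γ ∧ δ * b < η := by
  refine ⟨min (γ / (a + 1)) (η / (b + 1)), by positivity, ?_, ?_⟩
  · calc _ ≤ γ / (a + 1) * a := by gcongr; exact min_le_left _ _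
      _ < _ := by rw [div_mul_eq_mul_div, div_lt_iff₀ (by positivity)]; nlinarith
  · calc _ ≤ η / (b + 1) * b := by gcongr; exact min_le_right _ _
      _ < _ := by rw [div_mul_eq_mul_div, div_lt_iff₀ (by positivity)]; nlinarith

/-- Wherever the penalized function is positive, the bound `B` confines `y` and `x - y` to balls.
The value at `(t₁, x₁, x₁)` is positive, so a maximum over this compact set is global. -/
theorem exists_global_max_doubling {u v : ℝ → Sp d → ℝ} {Lu Lv : ℝ≥0} (hLu : LipOn T Lu u)
    (hLv : LipOn T Lv v) {B k σ M δ t₁ : ℝ} {x₁ : Sp d} (ht₁ : t₁ ∈ Icc 0 T)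
    (hB : ∀ t ∈ Icc 0 T, ∀ x y, u t x - v t y ≤ B) (hk : 0 < k) (hσ : 0 ≤ σ) (hM : 0 ≤ M)
    (hδ : 0 < δ) (hpos : 0 < u t₁ x₁ - v t₁ x₁ - σ * t₁ - δ * ‖x₁‖ ^ 2) :
    ∃ t₀ ∈ Icc 0 T, ∃ x₀ y₀, (u t₁ x₁ - v t₁ x₁ - σ * t₁ - δ * ‖x₁‖ ^ 2
        ≤ u t₀ x₀ - v t₀ y₀ - k * ‖x₀ - y₀‖ ^ 2 - σ * t₀ - M * max (t₀ - t₁) 0 ^ 2 - δ * ‖y₀‖ ^ 2) ∧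
      ∀ t ∈ Icc 0 T, ∀ x y,
        u t x - v t y - k * ‖x - y‖ ^ 2 - σ * t - M * max (t - t₁) 0 ^ 2 - δ * ‖y‖ ^ 2
        ≤ u t₀ x₀ - v t₀ y₀ - k * ‖x₀ - y₀‖ ^ 2 - σ * t₀ - M * max (t₀ - t₁) 0 ^ 2
          - δ * ‖y₀‖ ^ 2 := by
  set Φ : ℝ × Sp d × Sp d → ℝ := fun z => u z.1 z.2.1 - v z.1 z.2.2 - k * ‖z.2.1 - z.2.2‖ ^ 2
    - σ * z.1 - M * max (z.1 - t₁) 0 ^ 2 - δ * ‖z.2.2‖ ^ 2 with hΦ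
  set S : Set (ℝ × Sp d × Sp d) := Icc 0 T ×ˢ
    (Metric.closedBall 0 ((1 + B / δ) + (1 + B / k)) ×ˢ Metric.closedBall 0 (1 + B / δ)) with hS
  have hΦ₁ : Φ (t₁, x₁, x₁) = u t₁ x₁ - v t₁ x₁ - σ * t₁ - δ * ‖x₁‖ ^ 2 := by simp [hΦ]
  have hmem : ∀ t ∈ Icc 0 T, ∀ x y, 0 < Φ (t, x, y) → (t, x, y) ∈ S := by
    intro t ht x y hlt
    have h1 := hB t ht x y
    have h2 : 0 ≤ σ * t := mul_nonneg hσ ht.1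
    have h3 : 0 ≤ M * max (t - t₁) 0 ^ 2 := by positivity
    have h4 : 0 ≤ δ * ‖y‖ ^ 2 := by positivity
    have h5 : 0 ≤ k * ‖x - y‖ ^ 2 := by positivity
    simp only [hΦ] at hlt
    have h6 : ‖y‖ ^ 2 ≤ B / δ := by rw [le_div_iff₀ hδ]; linarith
    have h7 : ‖x - y‖ ^ 2 ≤ B / k := by rw [le_div_iff₀ hk]; linarith
    have h8 : ‖y‖ ≤ 1 + B / δ := by nlinarith [sq_nonneg (‖y‖ - 1)]
    have h9 : ‖x - y‖ ≤ 1 + B / k := by nlinarith [sq_nonneg (‖x - y‖ - 1)]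
    refine ⟨ht, ?_, ?_⟩
    · rw [mem_closedBall_zero_iff]
      have := norm_add_le y (x - y)
      rw [add_sub_cancel] at this
      exact this.trans (add_le_add h8 h9)
    · rwa [mem_closedBall_zero_iff]
  have hcomp : IsCompact S :=
    isCompact_Icc.prod ((isCompact_closedBall _ _).prod (isCompact_closedBall _ _))
  have hcont : ContinuousOn Φ S := by
    have h1 : ContinuousOn (fun z : ℝ × Sp d × Sp d => u z.1 z.2.1) S :=
      ContinuousOn.comp (g := fun z : ℝ × Sp d => u z.1 z.2)
        (f := fun z : ℝ × Sp d × Sp d => (z.1, z.2.1)) hLu.continuousOn (by fun_prop)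
        fun z hz => ⟨hz.1, mem_univ _⟩
    have h2 : ContinuousOn (fun z : ℝ × Sp d × Sp d => v z.1 z.2.2) S :=
      ContinuousOn.comp (g := fun z : ℝ × Sp d => v z.1 z.2)
        (f := fun z : ℝ × Sp d × Sp d => (z.1, z.2.2)) hLv.continuousOn (by fun_prop)
        fun z hz => ⟨hz.1, mem_univ _⟩
    exact ((((h1.sub h2).sub (Continuous.continuousOn (by fun_prop))).sub
      (Continuous.continuousOn (by fun_prop))).sub (Continuous.continuousOn (by fun_prop))).sub
      (Continuous.continuousOn (by fun_prop))
  have hz₁ : (t₁, x₁, x₁) ∈ S := hmem t₁ ht₁ x₁ x₁ (by rwa [hΦ₁])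
  obtain ⟨⟨t₀, x₀, y₀⟩, hz₀, hmax⟩ := hcomp.exists_isMaxOn ⟨_, hz₁⟩ hcont
  have hge : Φ (t₁, x₁, x₁) ≤ Φ (t₀, x₀, y₀) := hmax hz₁
  refine ⟨t₀, hz₀.1, x₀, y₀, by rwa [hΦ₁] at hge, fun t ht x y => ?_⟩
  change Φ (t, x, y) ≤ Φ (t₀, x₀, y₀)
  by_cases hc : 0 < Φ (t, x, y)
  · exact hmax (hmem t ht x y hc)
  · rw [hΦ₁] at hge
    linarith

theorem IsSchemeSolution.sub_supersolution_le (hH : HasLipschitzBounds T N K H) (hN : 0 ≤ N)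
    (hK : 0 ≤ K) (hh : 0 < h) (hq : ∀ x, |q x| ≤ K) (hqL : ∀ x y, |q x - q y| ≤ K * ‖x - y‖)
    (hu : IsSchemeSolution T N h H q u) {v : ℝ → Sp d → ℝ} {Lv : ℝ≥0} (hLv : LipOn T Lv v)
    (hv0 : ∀ x, v 0 x = q x)
    (hsuper : ∀ φ : ℝ × Sp d → ℝ, ContDiff ℝ 1 φ → ∀ t ∈ Ioo 0 T, ∀ x,
      IsLocalMin (fun z : ℝ × Sp d => v z.1 z.2 - φ z) (t, x) →
        0 ≤ deriv (fun s => φ (s, x)) t + H t x (gradient (fun y => φ (t, y)) x))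
    {t₁ : ℝ} (ht₁ : t₁ ∈ Ico 0 T) (x₁ : Sp d) :
    u t₁ x₁ - v t₁ x₁ ≤ (K ^ 2 / 2 + viscosityConst d T N K * T) * Real.sqrt h := by
  by_contra! hlt
  obtain ⟨Lu, hLu⟩ := hu.lipschitz
  have hT : 0 ≤ T := ht₁.1.trans ht₁.2.le
  have ht₁' : t₁ ∈ Icc 0 T := Ico_subset_Icc_self ht₁
  have hℓ := schemeLip_nonneg d hT hK
  have hV : 0 ≤ viscosityConst d T N K := by unfold viscosityConst; positivity
  set s := Real.sqrt h with hs
  have hs0 : 0 < s := Real.sqrt_pos.mpr hh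
  have hss : s * s = h := Real.mul_self_sqrt hh.le
  set σ := viscosityConst d T N K * s with hσ
  have hσ0 : 0 ≤ σ := by positivity
  set B := (K + Lu * T) + (K + Lv * T) with hBdef
  have hB0 : 0 ≤ B := by positivity
  have hB : ∀ t ∈ Icc 0 T, ∀ x y, u t x - v t y ≤ B := fun t ht x y => by
    have h1 := (abs_le.mp (hLu.abs_le hu.initial hq ht x)).2
    have h2 := (abs_le.mp (hLv.abs_le hv0 hq ht y)).1
    linarith
  -- This `k` makes both `N h · 2kd` and `schemeLip / k` of order `s = √h`.
  set k := 1 / (2 * s) with hk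
  have hk0 : 0 < k := by positivity
  have hks : 2 * k * s = 1 := by rw [hk]; field_simp
  -- At `t = T` the time penalty equals `B`, which keeps the maximum away from the final time; it
  -- vanishes up to `t₁`.
  set M := B / (T - t₁) ^ 2 with hM
  have hTt : 0 < T - t₁ := by linarith [ht₁.2]
  have hM0 : 0 ≤ M := by positivity
  have hγ : 0 < u t₁ x₁ - v t₁ x₁ - σ * t₁ - K ^ 2 * s / 2 := by
    have := mul_le_mul_of_nonneg_left ht₁.2.le hσ0
    rw [hσ] at this ⊢
    nlinarith
  -- The first smallness condition keeps the value at `(t₁, x₁, x₁)` above `K² s / 2`; the second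
  -- makes the gradient `2δ y₀` of the localization cost less than `s`.
  obtain ⟨δ, hδ, hδ1, hδ2⟩ := exists_pos_mul_lt_mul_lt (sq_nonneg ‖x₁‖)
    (by positivity : 0 ≤ 16 * N ^ 2 * B) hγ hh
  have hKs : 0 ≤ K ^ 2 * s / 2 := by positivity
  obtain ⟨t₀, ht₀, x₀, y₀, hge, hmax⟩ := exists_global_max_doubling hLu hLv (x₁ := x₁) ht₁' hB hk0
    hσ0 hM0 hδ (by linarith)
  have hval : K ^ 2 * s / 2 < u t₀ x₀ - v t₀ y₀ - k * ‖x₀ - y₀‖ ^ 2 - σ * t₀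
      - M * max (t₀ - t₁) 0 ^ 2 - δ * ‖y₀‖ ^ 2 := by linarith
  have hp1 : 0 ≤ σ * t₀ := mul_nonneg hσ0 ht₀.1
  have hp2 : 0 ≤ M * max (t₀ - t₁) 0 ^ 2 := by positivity
  have hp3 : 0 ≤ δ * ‖y₀‖ ^ 2 := by positivity
  have hp4 : 0 ≤ k * ‖x₀ - y₀‖ ^ 2 := by positivity
  have hne0 : t₀ ≠ 0 := by
    rintro rfl
    rw [hu.initial, hv0] at hval
    have h1 := (le_abs_self _).trans (hqL x₀ y₀)
    -- Completing the square: `K² s / 2` is the maximum of `Kr - k r²`, so at time zero the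
    -- Lipschitz datum cannot beat the penalty.
    have h2 : K * ‖x₀ - y₀‖ ≤ K ^ 2 * s / 2 + k * ‖x₀ - y₀‖ ^ 2 := by
      have h3 : K ^ 2 * s / 2 + k * ‖x₀ - y₀‖ ^ 2 - K * ‖x₀ - y₀‖
          = k * (‖x₀ - y₀‖ - K * s) ^ 2 := by
        rw [hk]; field_simp; ring
      have : 0 ≤ k * (‖x₀ - y₀‖ - K * s) ^ 2 := by positivity
      linarith
    linarith
  have hneT : t₀ ≠ T := by
    rintro rfl
    have h1 : M * max (t₀ - t₁) 0 ^ 2 = B := by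
      rw [max_eq_left hTt.le, hM]; field_simp
    linarith [hB t₀ ht₀ x₀ y₀]
  have hin : t₀ ∈ Ioo 0 T := ⟨lt_of_le_of_ne ht₀.1 (Ne.symm hne0), lt_of_le_of_ne ht₀.2 hneT⟩
  -- Comparison with `(t₀, y₀, y₀)` involves only increments of `u`, so the Lipschitz constant of
  -- `v` does not enter the rate.
  have hxy : ‖x₀ - y₀‖ ≤ 2 * schemeLip d T K * s := by
    have h1 := hmax t₀ ht₀ y₀ y₀
    rw [sub_self, norm_zero] at h1
    have h2 := (le_abs_self _).trans (hu.abs_sub_le hH hN hK hh hq hqL ht₀ x₀ y₀)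
    have h3 : k * ‖x₀ - y₀‖ ^ 2 ≤ schemeLip d T K * ‖x₀ - y₀‖ := by linarith
    rcases (norm_nonneg (x₀ - y₀)).eq_or_lt with h0 | h0
    · rw [← h0]; positivity
    · have h4 : k * ‖x₀ - y₀‖ ≤ schemeLip d T K := by
        refine le_of_mul_le_mul_right ?_ h0
        linarith
      have h5 := mul_le_mul_of_nonneg_right h4 (by positivity : 0 ≤ 2 * s)
      have h6 : k * ‖x₀ - y₀‖ * (2 * s) = 2 * k * s * ‖x₀ - y₀‖ := by ring
      rw [h6, hks, one_mul] at h5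
      linarith
  have hderiv := hu.deriv_le_of_touching hH hN hh (k := k) (x₀ := x₀) (y₀ := y₀) hin fun x => by
    linarith [hmax t₀ ht₀ x y₀]
  obtain ⟨c, hc⟩ := hu.exists_quadratic_le hH hN hK hh hin x₀
  set g := deriv (fun s => u s x₀) t₀
  have hmin : IsLocalMin (fun z : ℝ × Sp d => v z.1 z.2
      - ((g - σ - 2 * M * max (t₀ - t₁) 0) * (z.1 - t₀) - (c + M) * (z.1 - t₀) ^ 2
      - k * ‖z.2 - x₀‖ ^ 2 - δ * ‖z.2‖ ^ 2)) (t₀, y₀) := by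
    have hev : ∀ᶠ z : ℝ × Sp d in 𝓝 (t₀, y₀), z.1 ∈ Ioo 0 T :=
      continuous_fst.continuousAt.eventually (isOpen_Ioo.mem_nhds hin)
    filter_upwards [hev] with ⟨t, y⟩ ht
    have h1 := hmax t (Ioo_subset_Icc_self ht) x₀ y
    have h2 := hc t ht
    have h3 := mul_le_mul_of_nonneg_left (sq_posPart_le (t₀ - t₁) (t - t₁)) hM0
    rw [show t - t₁ - (t₀ - t₁) = t - t₀ by ring] at h3
    simp only [norm_sub_rev _ x₀]
    linarith
  have hvisc := supersolution_quadratic hsuper hin hmin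
  have hb1 := (abs_le.mp (hH.bound_p t₀ ht₀ y₀ ((2 * k) • (x₀ - y₀) - (2 * δ) • y₀)
    ((2 * k) • (x₀ - y₀)))).2
  rw [sub_sub_cancel_left, norm_neg, norm_smul, Real.norm_of_nonneg (by positivity)] at hb1
  have hb2 := (abs_le.mp (hH.bound_x t₀ ht₀ x₀ y₀ ((2 * k) • (x₀ - y₀)))).1
  have hp : ‖(2 * k) • (x₀ - y₀)‖ ≤ 2 * schemeLip d T K := by
    rw [norm_smul, Real.norm_of_nonneg (by positivity)]
    calc 2 * k * ‖x₀ - y₀‖ ≤ 2 * k * (2 * schemeLip d T K * s) := by gcongr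
      _ = 2 * k * s * (2 * schemeLip d T K) := by ring
      _ = _ := by rw [hks, one_mul]
  have hb3 : K * (1 + ‖(2 * k) • (x₀ - y₀)‖) * ‖x₀ - y₀‖
      ≤ K * (1 + 2 * schemeLip d T K) * (2 * schemeLip d T K * s) := by gcongr
  have hy : 2 * N * (2 * δ * ‖y₀‖) < s := by
    refine lt_of_pow_lt_pow_left₀ 2 hs0.le ?_
    have h1 : δ * ‖y₀‖ ^ 2 ≤ B := by linarith [hB t₀ ht₀ x₀ y₀]
    have h2 := mul_le_mul_of_nonneg_left h1 (by positivity : 0 ≤ 16 * N ^ 2 * δ)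
    rw [sq s, hss]
    calc (2 * N * (2 * δ * ‖y₀‖)) ^ 2 = 16 * N ^ 2 * δ * (δ * ‖y₀‖ ^ 2) := by ring
      _ ≤ 16 * N ^ 2 * δ * B := h2
      _ = δ * (16 * N ^ 2 * B) := by ring
      _ < h := hδ2
  -- The time penalty contributes with a favourable sign, so the large constant `M` is harmless. The
  -- final contradiction is strict because the `+ 1` in `viscosityConst` covers the localization
  -- error `hy`.
  have hmp : 0 ≤ 2 * M * max (t₀ - t₁) 0 := by positivity
  have hlap : N * h * (2 * k * d) = N * d * s := by
    rw [← hss]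
    linear_combination N * d * s * hks
  rw [hσ, viscosityConst] at hvisc
  linarith

end Viscosity

/-! ### Two-sided convergence rate and decay of the gradient error. -/

section ErrorEstimates

variable {d : ℕ} {T N h : ℝ} {K : ℝ≥0} {H : ℝ → Sp d → Sp d → ℝ} {q : Sp d → ℝ}
  {α : ℝ → Sp d → Sp d → Sp d} {u : ℝ → Sp d → ℝ}

theorem gradient_fun_neg (f : Sp d → ℝ) (x : Sp d) :
    gradient (fun y => -f y) x = -gradient f x := by
  rw [gradient, gradient, fderiv_fun_neg, map_neg]

theorem IsSchemeSolution.abs_sub_viscosity_le (hH : HasLipschitzBounds T N K H) (hN : 0 ≤ N)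
    (hT : 0 < T) (hh : 0 < h) (hq : ∀ x, |q x| ≤ K) (hqL : LipschitzWith K q)
    (hu : IsSchemeSolution T N h H q u) {v : ℝ → Sp d → ℝ} (hv : IsViscositySolution T H q v)
    {t : ℝ} (ht : t ∈ Icc 0 T) (x : Sp d) :
    |u t x - v t x| ≤ ((K : ℝ) ^ 2 / 2 + viscosityConst d T N K * T) * Real.sqrt h := by
  obtain ⟨Lu, hLu⟩ := hu.lipschitz
  obtain ⟨Lv, hLv⟩ := hv.lipschitz
  have hqL' : ∀ x y, |q x - q y| ≤ K * ‖x - y‖ := fun x y => by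
    simpa [Real.dist_eq, dist_eq_norm] using hqL.dist_le_mul x y
  have key : ∀ t ∈ Ico 0 T,
      |u t x - v t x| ≤ ((K : ℝ) ^ 2 / 2 + viscosityConst d T N K * T) * Real.sqrt h := by
    intro t ht
    have h1 := hu.sub_supersolution_le hH hN K.coe_nonneg hh hq hqL' hLv hv.initial
      hv.supersolution ht x
    have hLv' : LipOn T Lv fun t x => -v t x := LipschitzOnWith.of_dist_le_mul fun a ha b hb => by
      rw [dist_neg_neg]; exact hLv.dist_le_mul a ha b hb
    -- A subsolution `v` for `H` gives a supersolution `-v` for `-H(t,x,-p)`.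
    have h2 := hu.reflect.sub_supersolution_le hH.reflect hN K.coe_nonneg hh
      (fun x => by simpa using hq x)
      (fun x y => by rw [neg_sub_neg, abs_sub_comm]; exact hqL' x y) hLv'
      (fun x => by rw [hv.initial])
      (fun φ hφ t ht x hmin => by
        have h3 := hv.subsolution (fun z => -φ z) hφ.neg t ht x
          (by simpa only [neg_sub, sub_neg_eq_add, add_comm] using hmin.neg)
        rw [deriv.fun_neg, gradient_fun_neg] at h3
        linarith) ht x
    exact abs_le.mpr ⟨by linarith, h1⟩
  have hcont : ContinuousOn (fun t => |u t x - v t x|) (Icc 0 T) :=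
    ((hLu.continuousOn_time x).sub (hLv.continuousOn_time x)).abs
  -- The final time, excluded by the penalization, is recovered by continuity.
  rw [← closure_Ico hT.ne] at ht hcont
  exact le_on_closure (g := fun _ => _) key hcont continuousOn_const ht

/-- Multiplying the Lipschitz bound by the sup bound gives exactly the power `1/h`, valid for small
and large `h` alike; squaring either bound alone gives the wrong power. -/
theorem norm_gradH_start_sub_sq_le (hN : 0 ≤ N) (hh : 0 < h) (hH : HasLipschitzBounds T N K H)
    (hq : ∀ x, |q x| ≤ K) (hqL : LipschitzWith K q) (hu : IsSchemeSolution T N h H q u)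
    {v : ℕ → ℝ → Sp d → ℝ} (hv : IsPolicyIteration T N K h H α q v) {t : ℝ} (ht : t ∈ Icc 0 T)
    (x : Sp d) :
    ‖gradH h (fun y => v 0 t y - u t y) x‖ ^ 2
      ≤ d * (K + schemeLip d T K) * (d * (K + (K + K * T))) / h := by
  have h1 := norm_gradH_start_sub_le hN hh hH hq hqL hu hv ht x
  have h2 := norm_gradH_le_of_abs_le hh (φ := fun y => v 0 t y - u t y) (B := K + (K + K * T))
    (fun y => (abs_sub _ _).trans (add_le_add (hv.start_bounded t ht y)
      (hu.abs_le_bound hH hN K.coe_nonneg hh hq ht y))) x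
  rw [sq, mul_div_assoc]
  exact mul_le_mul h1 h2 (norm_nonneg _) ((norm_nonneg _).trans h1)

/-- Geometric decay of the gradient of the error of policy iteration. -/
theorem IsPolicyIteration.norm_gradH_sub_sq_le (hN : 0 ≤ N) (hT : 0 ≤ T) (hh : 0 < h)
    (hH : HasLipschitzBounds T N K H) (hq : ∀ x, |q x| ≤ K) (hqL : LipschitzWith K q)
    (hα : IsPolicyMap T H α) (hu : IsSchemeSolution T N h H q u) {v : ℕ → ℝ → Sp d → ℝ}
    (hv : IsPolicyIteration T N K h H α q v) (n : ℕ) {t : ℝ} (ht : t ∈ Icc 0 T) (x : Sp d) :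
    ‖gradH h (fun y => v n t y - u t y) x‖ ^ 2
      ≤ (d * (K + schemeLip d T K) * (d * (K + (K + K * T)))
          + d ^ 2 * (2 * policyConst d T N K ^ 2 * T)) * (2 ^ n)⁻¹
        * Real.exp ((16 * N * d + 1) * t / h) / h := by
  have hℓ := schemeLip_nonneg d hT K.coe_nonneg
  have ht0 := ht.1
  have hE : 1 ≤ Real.exp ((16 * N * d + 1) * t / h) := Real.one_le_exp (by positivity)
  rcases Nat.eq_zero_or_pos n with rfl | hn
  · refine (norm_gradH_start_sub_sq_le hN hh hH hq hqL hu hv ht x).trans ?_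
    rw [pow_zero, inv_one, mul_one]
    refine div_le_div_of_nonneg_right ?_ hh.le
    exact (le_add_of_nonneg_right (by positivity)).trans
      (le_mul_of_one_le_right (by positivity) hE)
  · have h1 := norm_gradH_le_of_abs_le hh (φ := fun y => v n t y - u t y)
      (fun y => Real.le_sqrt_of_sq_le (hv.sq_abs_sub_le hN hT hh hH hq hqL hα hu hn ht y)) x
    refine (pow_le_pow_left₀ (norm_nonneg _) h1 2).trans ?_
    rw [div_pow, mul_pow, Real.sq_sqrt (by positivity)]
    calc _ = d ^ 2 * (2 * policyConst d T N K ^ 2 * T) * (2 ^ n)⁻¹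
          * Real.exp ((16 * N * d + 1) * t / h) / h := by field_simp
      _ ≤ _ := by
        gcongr
        exact le_add_of_nonneg_left (by positivity)

end ErrorEstimates

/-! ### The main theorem: choice of constants and assembly. -/

theorem theorem5p2 (d : ℕ) (T N : ℝ) (K : ℝ≥0) (hT : 0 < T) (hN : 1 ≤ N) :
    ∃ C : ℝ, 0 < C ∧ ∃ C' : ℝ≥0 → ℝ,
      ∀ (H : ℝ → Sp d → Sp d → ℝ) (q : Sp d → ℝ),
        IsAdmissibleHamiltonian T N K H → (∀ x, |q x| ≤ K) → LipschitzWith K q →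
        ∀ h : ℝ, 0 < h → ∀ vh : ℝ → Sp d → ℝ, IsSchemeSolution T N h H q vh →
          (∀ (α : ℝ → Sp d → Sp d → Sp d) (vn : ℕ → ℝ → Sp d → ℝ),
            IsPolicyMap T H α → IsPolicyIteration T N K h H α q vn →
            (∀ n : ℕ, 1 ≤ n → ∀ R : ℝ, 1 ≤ R → ∀ t ∈ Icc 0 T,
              ∫ x in Metric.ball (0 : Sp d) R, |vn n t x - vh t x| ^ 2
                ≤ C * (2 ^ n)⁻¹ * h * Real.exp (C * t / h) * R ^ d) ∧
            (∀ Λ : ℝ≥0, (∀ t ∈ Icc 0 T, ∀ x, LipschitzWith Λ (α t x)) →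
              ∀ n : ℕ, ∀ R : ℝ, 1 ≤ R → ∀ t ∈ Icc 0 T,
              ∫ x in Metric.ball (0 : Sp d) R,
                  ‖α t x (gradH h (vn n t) x) - α t x (gradH h (vh t) x)‖ ^ 2
                ≤ C' Λ * (2 ^ n)⁻¹ * Real.exp (C' Λ * t / h) * R ^ d / h)) ∧
          (∀ v : ℝ → Sp d → ℝ, IsViscositySolution T H q v →
            ∀ t ∈ Icc 0 T, ∀ x, |vh t x - v t x| ≤ C * Real.sqrt h) := by
  have hN0 : 0 ≤ N := zero_le_one.trans hN
  have hℓ := schemeLip_nonneg d hT.le K.coe_nonneg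
  set V := volume.real (Metric.ball (0 : Sp d) 1) with hV
  have hV0 : 0 ≤ V := measureReal_nonneg
  set a := 2 * policyConst d T N K ^ 2 * T with ha
  set b := d * (K + schemeLip d T K) * (d * (K + (K + K * T))) + d ^ 2 * a with hb
  set Q := 16 * N * d + 1 with hQ
  set r := (K : ℝ) ^ 2 / 2 + viscosityConst d T N K * T with hr
  have ha0 : 0 ≤ a := by positivity
  have hb0 : 0 ≤ b := by positivity
  have hQ0 : 0 < Q := by positivity
  have hr0 : 0 ≤ r := by rw [hr, viscosityConst]; positivity
  -- The same constant serves as prefactor, as exponential rate and, for `C`, as convergence rate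
  -- factor, so the separate constants are added.
  refine ⟨a * V + Q + r, by positivity, fun Λ => (Λ : ℝ) ^ 2 * b * V + Q, ?_⟩
  intro H q hA hq hqL h hh vh hvh
  have hH := hA.hasLipschitzBounds
  refine ⟨fun α vn hα hvn => ⟨fun n hn R hR t ht => ?_, fun Λ hΛ n R hR t ht => ?_⟩,
    fun v hv t ht x => ?_⟩
  · have ht0 := ht.1
    have hR0 : 0 < R := one_pos.trans_le hR
    calc ∫ x in Metric.ball (0 : Sp d) R, |vn n t x - vh t x| ^ 2
        ≤ a * (2 ^ n)⁻¹ * h * Real.exp (Q * t / h) * V * R ^ d :=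
          setIntegral_ball_le (fun x => by
            rw [abs_of_nonneg (by positivity)]
            exact hvn.sq_abs_sub_le hN0 hT.le hh hH hq hqL hα hvh hn ht x) hR0
      _ = (a * V) * (2 ^ n)⁻¹ * h * Real.exp (Q * t / h) * R ^ d := by ring
      _ ≤ _ := by
          have h1 : a * V ≤ a * V + Q + r := by linarith
          have h2 : Q ≤ a * V + Q + r := by have := mul_nonneg ha0 hV0; linarith
          gcongr
  · have ht0 := ht.1
    have hR0 : 0 < R := one_pos.trans_le hR
    calc ∫ x in Metric.ball (0 : Sp d) R,
          ‖α t x (gradH h (vn n t) x) - α t x (gradH h (vh t) x)‖ ^ 2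
        ≤ (Λ : ℝ) ^ 2 * (b * (2 ^ n)⁻¹ * Real.exp (Q * t / h) / h) * V * R ^ d :=
          setIntegral_ball_le (fun x => by
            rw [abs_of_nonneg (by positivity)]
            have h1 := (hΛ t ht x).norm_sub_le (gradH h (vn n t) x) (gradH h (vh t) x)
            have h2 := hvn.norm_gradH_sub_sq_le hN0 hT.le hh hH hq hqL hα hvh n ht x
            rw [gradH_sub] at h2
            refine (pow_le_pow_left₀ (norm_nonneg _) h1 2).trans ?_
            rw [mul_pow]
            exact mul_le_mul_of_nonneg_left h2 (by positivity)) hR0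
      _ = (Λ : ℝ) ^ 2 * b * V * (2 ^ n)⁻¹ * Real.exp (Q * t / h) * R ^ d / h := by ring
      _ ≤ _ := by
          have h1 : (Λ : ℝ) ^ 2 * b * V ≤ (Λ : ℝ) ^ 2 * b * V + Q := by linarith
          have h2 : Q ≤ (Λ : ℝ) ^ 2 * b * V + Q := by
            have : 0 ≤ (Λ : ℝ) ^ 2 * b * V := by positivity
            linarith
          gcongr
  · refine (hvh.abs_sub_viscosity_le hH hN0 hT hh hq hqL hv ht x).trans ?_
    have := mul_nonneg ha0 hV0
    exact mul_le_mul_of_nonneg_right (by linarith) (Real.sqrt_nonneg h)
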